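/- Let $n\ge 0$ and $k\ge 2$ be integers and let $G$ be a finite directed multigraph (loops and multi-edges allowed) with $n$ vertices in which every vertex has outdegree exactly $k$, counted with multiplicity. A \emph{path-cycle} is a digraph isomorphic to $$\bigl(\{v_1,\dots,v_r\},\ \{(v_i,v_{i+1}) : 1\le i<r\}\cup\{(v_r,v_m)\}\bigr)$$ with $v_1,\dots,v_r$ distinct and $1\le m\le r$. For a digraph $H$ let $C'(H)$ be the number of subgraphs of $H$ that are path-cycles, where parallel edges are regarded as distinct (so path-cycles using different edges of the same multi-edge are different). Let $N_1(G)=C'(G')$, where $G'$ is obtained from $G$ by replacing each multi-edge of multiplicity exactly $k$ by an edge of multiplicity $1$, leaving all other multi-edges unchanged, and let $N_2(G)=C'(\mathrm{Skel}(G))$, where the skeleton $\mathrm{Skel}(G)$ is obtained from $G$ by replacing every multi-edge by an edge of multiplicity $1$. Put $$\alpha(k)=\frac{k-1+\sqrt{(k-1)^2+4}}{2}.$$ Then \begin{enumerate} \item[(1)] $N_1(G)\le 5\,n^2\,k\,\alpha(k)^{n-1}$, and \item[(2)] $N_2(G)\le n^2\,k\,\bigl((k+1)!\bigr)^{(n-1)/(k+1)}$.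 \end{enumerate} -/

import Mathlib

/-- A finite directed multigraph on the vertex set `V`, loops and parallel edges allowed, given by
the multiplicity of the multi-edge from `u` to `v` (multiplicity `0` means that there is no edge). -/
structure MultiDigraph (V : Type*) where
  mult : V → V → ℕ

namespace MultiDigraph

variable {V : Type*}

/-- The individual edges of `G`: a multi-edge `(u, v)` consists of `mult u v` distinct edges. -/
def Edge (G : MultiDigraph V) : Type _ := Σ p : V × V, Fin (G.mult p.1 p.2)

/-- The source of an edge. -/
def Edge.src {G : MultiDigraph V} (e : G.Edge) : V := e.1.1

/-- The target of an edge. -/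
def Edge.tgt {G : MultiDigraph V} (e : G.Edge) : V := e.1.2

/-- The outdegree of a vertex, counted with multiplicity. -/
def outdegree [Fintype V] (G : MultiDigraph V) (v : V) : ℕ := ∑ w, G.mult v w

/-- A subgraph: a set of vertices and a set of individual edges with end points among them. -/
@[ext]
structure Subgraph (G : MultiDigraph V) where
  verts : Set V
  edges : Set G.Edge
  src_mem : ∀ e ∈ edges, e.src ∈ verts
  tgt_mem : ∀ e ∈ edges, e.tgt ∈ verts

/-- A subgraph is a path-cycle if it is isomorphic to the digraph with vertices `v 0, …, v r`
(pairwise distinct), exactly one edge from `v i` to `v (i + 1)` for each `i < r`, exactly one edge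
from `v r` to `v m` for some `m ≤ r`, and no other edges. -/
def Subgraph.IsPathCycle {G : MultiDigraph V} (H : G.Subgraph) : Prop :=
  ∃ (r m : ℕ) (v : Fin (r + 1) → V) (e : Fin (r + 1) → G.Edge) (hm : m < r + 1),
    Function.Injective v ∧ H.verts = Set.range v ∧ H.edges = Set.range e ∧
    (∀ i, (e i).src = v i) ∧
    (∀ i : Fin r, (e i.castSucc).tgt = v i.succ) ∧
    (e (Fin.last r)).tgt = v ⟨m, hm⟩

instance [Finite V] (G : MultiDigraph V) : Finite G.Edge := by
  unfold Edge; infer_instance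

instance [Finite V] (G : MultiDigraph V) : Finite G.Subgraph :=
  Finite.of_injective (fun H : G.Subgraph => (H.verts, H.edges)) fun H K h => by
    simp only [Prod.mk.injEq] at h
    exact Subgraph.ext h.1 h.2

/-- The number of path-cycles in `G`. -/
noncomputable def numPathCycles (G : MultiDigraph V) : ℕ :=
  Nat.card {H : G.Subgraph // H.IsPathCycle}

/-- The skeleton of `G`: every multi-edge is replaced by an edge of multiplicity `1`. -/
def skel (G : MultiDigraph V) : MultiDigraph V where
  mult u v := if G.mult u v = 0 then 0 else 1

/-- The digraph obtained from `G` by replacing each multi-edge of multiplicity `k` by an edge of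
multiplicity `1`; all other multiplicities are kept. -/
def collapse (G : MultiDigraph V) (k : ℕ) : MultiDigraph V where
  mult u v := if G.mult u v = k then 1 else G.mult u v

/-- `N₁(G)` for a digraph `G` of outdegree `k`. -/
noncomputable def N₁ (G : MultiDigraph V) (k : ℕ) : ℕ := (G.collapse k).numPathCycles

/-- `N₂(G)`. -/
noncomputable def N₂ (G : MultiDigraph V) : ℕ := G.skel.numPathCycles

/-- `α(k) = (k - 1 + √((k - 1)² + 4)) / 2`. -/
noncomputable def α (k : ℕ) : ℝ := ((k : ℝ) - 1 + √(((k : ℝ) - 1) ^ 2 + 4)) / 2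

end MultiDigraph

/-! A path-cycle is a path from some `s` to some `t` together with one of at most `k` edges leaving
`t`, so there are at most `k` times as many path-cycles as paths (`numPathCycles_le`). With `n ^ 2`
pairs `(s, t)`, it suffices to bound the number of paths between two fixed vertices.

For (1), put `m = k - 1` and let `a = α k`, the positive root of `a ^ 2 = m * a + 1`. After
collapsing, every outdegree is at most `m + 1` and every multiplicity at most `m`. `pathBound` shows
by induction on the vertex set that the number of paths is at most a product of vertex weights: `a`
for outdegree bound `m + 1`, and `(m * c + 1) / a` for a bound `c ≤ m`. Edges into the start do not
count, so an in-edge of the start lowers a weight. The path count is affine in each row, so rows may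
be made extremal. If some `c ≤ m`, that vertex sends all its edges to one vertex `y`, and a set
funnelling into `y` is contracted (`exists_isAbsorbing`). Otherwise every row has `m` edges to one
vertex and one edge to another; removing the start leaves two weighted starting points, and
`two_sources_le` finishes.

For (2), a path in a simple digraph extends by fixed points to a perfect matching between the
vertices other than `t` and those other than `s`, with rows of size at most `k + 1`; Bregman's
theorem bounds the number of these. -/

namespace MultiDigraph

/-! ### Counting paths; deleting a vertex; dependence on a single row. -/

section PathCount

variable {V : Type*} [Fintype V] [DecidableEq V]

/-- The number of paths from `v` to `t` with vertices in `A`, counted with multiplicity. -/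
noncomputable def pathCount (M : V → V → ℕ) (t : V) (A : Finset V) (v : V) : ℝ :=
  if v ∈ A then
    if v = t then 1 else ∑ u, (M v u : ℝ) * pathCount M t (A.erase v) u
  else 0
termination_by A.card
decreasing_by exact Finset.card_erase_lt_of_mem ‹_›

variable {M M' : V → V → ℕ} {t : V} {A : Finset V} {v : V}

theorem pathCount_of_notMem (h : v ∉ A) : pathCount M t A v = 0 := by
  rw [pathCount]; simp [h]

theorem pathCount_target (h : t ∈ A) : pathCount M t A t = 1 := by
  rw [pathCount]; simp [h]

theorem pathCount_step (h : v ∈ A) (hv : v ≠ t) :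
    pathCount M t A v = ∑ u, (M v u : ℝ) * pathCount M t (A.erase v) u := by
  rw [pathCount]; simp [h, hv]

theorem pathCount_nonneg (M : V → V → ℕ) (t : V) (A : Finset V) (v : V) :
    0 ≤ pathCount M t A v := by
  induction A using Finset.strongInduction generalizing v with
  | H A ih =>
    rw [pathCount]
    split_ifs with h1 h2
    · exact zero_le_one
    · exact Finset.sum_nonneg fun u _ =>
        mul_nonneg (Nat.cast_nonneg _) (ih _ (Finset.erase_ssubset h1) u)
    · exact le_rfl

theorem pathCount_congr (h : ∀ w ∈ A, ∀ u ∈ A, M w u = M' w u) :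
    pathCount M t A v = pathCount M' t A v := by
  induction A using Finset.strongInduction generalizing v with
  | H A ih =>
    by_cases hA : v ∈ A
    · by_cases hv : v = t
      · subst hv; rw [pathCount_target hA, pathCount_target hA]
      · rw [pathCount_step hA hv, pathCount_step hA hv]
        refine Finset.sum_congr rfl fun u _ => ?_
        by_cases hu : u ∈ A.erase v
        · rw [h v hA u (Finset.mem_of_mem_erase hu), ih _ (Finset.erase_ssubset hA)
            fun w hw u hu => h w (Finset.mem_of_mem_erase hw) u (Finset.mem_of_mem_erase hu)]
        · rw [pathCount_of_notMem hu, pathCount_of_notMem hu, mul_zero, mul_zero]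
    · rw [pathCount_of_notMem hA, pathCount_of_notMem hA]

/-- Edges into the start of a path are irrelevant. -/
theorem pathCount_eq_of_forall_ne (h : ∀ w ∈ A, ∀ u ∈ A, u ≠ v → M w u = M' w u) :
    pathCount M t A v = pathCount M' t A v := by
  by_cases hA : v ∈ A
  · by_cases hv : v = t
    · subst hv; rw [pathCount_target hA, pathCount_target hA]
    · rw [pathCount_step hA hv, pathCount_step hA hv]
      refine Finset.sum_congr rfl fun u _ => ?_
      by_cases hu : u ∈ A.erase v
      · rw [h v hA u (Finset.mem_of_mem_erase hu) (Finset.ne_of_mem_erase hu),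
          pathCount_congr fun w hw u hu => h w (Finset.mem_of_mem_erase hw) u
            (Finset.mem_of_mem_erase hu) (Finset.ne_of_mem_erase hu)]
      · rw [pathCount_of_notMem hu, pathCount_of_notMem hu, mul_zero, mul_zero]
  · rw [pathCount_of_notMem hA, pathCount_of_notMem hA]

theorem pathCount_update_of_notMem {z : V} (hz : z ∉ A) (row : V → ℕ) :
    pathCount (Function.update M z row) t A v = pathCount M t A v :=
  pathCount_congr fun w hw u _ => by
    rw [Function.update_of_ne (by rintro rfl; exact hz hw)]

/-- Paths either avoid `p` or reach it by an edge from some `z`, which may then be contracted. -/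
theorem pathCount_le_erase_add_sum (M : V → V → ℕ) {p : V} (hp : p ≠ t) (A : Finset V) {v : V}
    (hv : v ≠ p) :
    pathCount M t A v ≤ pathCount M t (A.erase p) v + ∑ z ∈ (A.erase p).erase t,
      (M z p : ℝ) * pathCount (Function.update M z (M p)) t (A.erase p) v := by
  have hnn : ∀ (A B : Finset V) (v : V), 0 ≤ ∑ z ∈ B,
      (M z p : ℝ) * pathCount (Function.update M z (M p)) t A v := fun A B v =>
    Finset.sum_nonneg fun z _ => mul_nonneg (Nat.cast_nonneg _) (pathCount_nonneg _ _ _ _)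
  induction A using Finset.strongInduction generalizing v with
  | H A ih =>
    by_cases hA : v ∈ A
    swap
    · rw [pathCount_of_notMem hA]
      exact add_nonneg (pathCount_nonneg _ _ _ _) (hnn _ _ _)
    have hAp : v ∈ A.erase p := Finset.mem_erase.2 ⟨hv, hA⟩
    by_cases hvt : v = t
    · subst hvt
      rw [pathCount_target hA, pathCount_target hAp]
      exact le_add_of_nonneg_right (hnn _ _ _)
    have hvB : v ∈ (A.erase p).erase t := Finset.mem_erase.2 ⟨hvt, hAp⟩
    -- The summand `z = v` is split off: it accounts for the paths whose first step is to `p`. The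
    -- summands `z ≠ v` and the paths avoiding `p` come from induction at the next vertex.
    rw [← Finset.add_sum_erase _ _ hvB, pathCount_step hA hvt, pathCount_step hAp hvt,
      pathCount_step (M := Function.update M v (M p)) hAp hvt]
    have e1 : (A.erase p).erase v = (A.erase v).erase p := Finset.erase_right_comm
    have e2 : ((A.erase p).erase t).erase v = ((A.erase v).erase p).erase t := by
      ext; simp only [Finset.mem_erase]; tauto
    rw [e1, e2]
    have h3 : ∑ z ∈ ((A.erase v).erase p).erase t,
        (M z p : ℝ) * pathCount (Function.update M z (M p)) t (A.erase p) v =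
        ∑ u, (M v u : ℝ) * ∑ z ∈ ((A.erase v).erase p).erase t, (M z p : ℝ) *
          pathCount (Function.update M z (M p)) t ((A.erase v).erase p) u := by
      simp_rw [Finset.mul_sum]
      rw [Finset.sum_comm]
      refine Finset.sum_congr rfl fun z hz => ?_
      have hzv : v ≠ z := by
        rintro rfl
        simp at hz
      rw [pathCount_step hAp hvt, Finset.mul_sum, e1, Function.update_of_ne hzv]
      exact Finset.sum_congr rfl fun u _ => by ring
    rw [h3, Function.update_self]
    have h4 : ∀ u, pathCount (Function.update M v (M p)) t ((A.erase v).erase p) u =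
        pathCount M t ((A.erase v).erase p) u := fun u =>
      pathCount_update_of_notMem (by simp) _
    simp_rw [h4]
    have h5 : pathCount M t (A.erase v) p ≤
        ∑ u, (M p u : ℝ) * pathCount M t ((A.erase v).erase p) u := by
      by_cases hpA : p ∈ A.erase v
      · rw [pathCount_step hpA hp]
      · rw [pathCount_of_notMem hpA]
        exact Finset.sum_nonneg fun u _ => mul_nonneg (Nat.cast_nonneg _) (pathCount_nonneg _ _ _ _)
    have h6 : ∀ u, (M v u : ℝ) * pathCount M t (A.erase v) u ≤
        (M v u : ℝ) * pathCount M t ((A.erase v).erase p) u +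
        (M v u : ℝ) * (∑ z ∈ ((A.erase v).erase p).erase t, (M z p : ℝ) *
          pathCount (Function.update M z (M p)) t ((A.erase v).erase p) u) +
        if u = p then (M v p : ℝ) *
          ∑ u, (M p u : ℝ) * pathCount M t ((A.erase v).erase p) u else 0 := by
      intro u
      rw [← mul_add]
      split_ifs with hu
      · subst hu
        have := mul_le_mul_of_nonneg_left h5 (Nat.cast_nonneg (α := ℝ) (M v u))
        have h7 := mul_nonneg (Nat.cast_nonneg (α := ℝ) (M v u))
          (add_nonneg (pathCount_nonneg M t ((A.erase v).erase u) u)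
          (hnn ((A.erase v).erase u) (((A.erase v).erase u).erase t) u))
        linarith
      · rw [add_zero]
        exact mul_le_mul_of_nonneg_left (ih _ (Finset.erase_ssubset hA) hu) (Nat.cast_nonneg _)
    refine (Finset.sum_le_sum fun u _ => h6 u).trans ?_
    rw [Finset.sum_add_distrib, Finset.sum_add_distrib, Finset.sum_ite_eq' Finset.univ p]
    simp only [Finset.mem_univ, if_true]
    linarith

theorem pathCount_le_erase_of_no_inEdge {p : V} (hp : p ≠ t) (hv : v ≠ p)
    (h : ∀ z ∈ A, z ≠ p → z ≠ t → M z p = 0) :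
    pathCount M t A v ≤ pathCount M t (A.erase p) v := by
  refine (pathCount_le_erase_add_sum M hp A hv).trans (le_of_eq ?_)
  rw [Finset.sum_eq_zero, add_zero]
  intro z hz
  simp only [Finset.mem_erase] at hz
  rw [h z hz.2.2 hz.2.1 hz.1, Nat.cast_zero, zero_mul]

/-- The number of paths is an affine function of each row. -/
theorem exists_affine_row (M : V → V → ℕ) (t : V) (A : Finset V) (v z : V) :
    ∃ (R : ℝ) (T : V → ℝ), (∀ u, 0 ≤ T u) ∧ T z = 0 ∧ (∀ u ∉ A, T u = 0) ∧
      ∀ row : V → ℕ, pathCount (Function.update M z row) t A v = R + ∑ u, (row u : ℝ) * T u := by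
  induction A using Finset.strongInduction generalizing v with
  | H A ih =>
    by_cases hA : v ∈ A
    swap
    · exact ⟨0, fun _ => 0, by simp, rfl, by simp, fun row => by simp [pathCount_of_notMem hA]⟩
    by_cases hvt : v = t
    · subst hvt
      exact ⟨1, fun _ => 0, by simp, rfl, by simp, fun row => by simp [pathCount_target hA]⟩
    by_cases hvz : v = z
    · subst hvz
      -- The row of `z` is read here and never again, since `z` now leaves the vertex set.
      refine ⟨0, fun u => pathCount M t (A.erase v) u, fun u => pathCount_nonneg _ _ _ _,
        pathCount_of_notMem (by simp),
        fun u hu => pathCount_of_notMem fun h => hu (Finset.mem_of_mem_erase h), fun row => ?_⟩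
      rw [pathCount_step hA hvt, zero_add, Function.update_self]
      exact Finset.sum_congr rfl fun u _ => by rw [pathCount_update_of_notMem (by simp)]
    · choose R T h0 h1 h2 h3 using fun u => ih _ (Finset.erase_ssubset hA) u
      refine ⟨∑ u, (M v u : ℝ) * R u, fun w => ∑ u, (M v u : ℝ) * T u w,
        fun w => Finset.sum_nonneg fun u _ => mul_nonneg (Nat.cast_nonneg _) (h0 u w),
        Finset.sum_eq_zero fun u _ => by rw [h1, mul_zero],
        fun w hw => Finset.sum_eq_zero fun u _ => by
          rw [h2 u w fun h => hw (Finset.mem_of_mem_erase h), mul_zero], fun row => ?_⟩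
      rw [pathCount_step hA hvt, Function.update_of_ne hvz]
      simp_rw [h3, mul_add, Finset.sum_add_distrib, Finset.mul_sum]
      rw [add_right_inj, Finset.sum_comm]
      exact Finset.sum_congr rfl fun u _ => Finset.sum_congr rfl fun w _ => by ring

end PathCount

/-! ### Extremal rows, and contraction of absorbing sets. -/

section Absorption

variable {V : Type*} [Fintype V] [DecidableEq V]

-- With entries at most `m` and total at most `m + 1`, the best choice puts `m` on the largest value
-- of `T` and the remaining unit on the runner-up.
omit [Fintype V] in
theorem sum_mul_le_of_le {B : Finset V} {a : V → ℕ} {T : V → ℝ} {m : ℕ} {y : V} {τ : ℝ}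
    (hsum : ∑ u ∈ B, a u ≤ m + 1) (hent : ∀ u ∈ B, a u ≤ m) (hy : y ∈ B) (h0 : 0 ≤ τ)
    (hτ : τ ≤ T y) (h : ∀ u ∈ B, u ≠ y → T u ≤ τ) :
    ∑ u ∈ B, (a u : ℝ) * T u ≤ m * T y + τ := by
  rw [← Finset.add_sum_erase _ _ hy] at hsum ⊢
  have h1 : ∑ u ∈ B.erase y, (a u : ℝ) * T u ≤ (∑ u ∈ B.erase y, (a u : ℝ)) * τ := by
    rw [Finset.sum_mul]
    refine Finset.sum_le_sum fun u hu => ?_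
    rw [Finset.mem_erase] at hu
    exact mul_le_mul_of_nonneg_left (h u hu.2 hu.1) (Nat.cast_nonneg _)
  have h2 : (a y : ℝ) + ∑ u ∈ B.erase y, (a u : ℝ) ≤ m + 1 := by exact_mod_cast hsum
  have h3 : (a y : ℝ) ≤ m := by exact_mod_cast hent y hy
  nlinarith [mul_nonneg (sub_nonneg.2 h3) (sub_nonneg.2 hτ),
    mul_le_mul_of_nonneg_right h2 h0]

/-- The row of a vertex with `m` edges to `p` and one edge to `q`. -/
def stdRow (m : ℕ) (p q : V) (u : V) : ℕ := (if u = p then m else 0) + if u = q then 1 else 0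

omit [Fintype V] in
theorem sum_stdRow (m : ℕ) (p q : V) (B : Finset V) :
    ∑ u ∈ B, stdRow m p q u = (if p ∈ B then m else 0) + if q ∈ B then 1 else 0 := by
  simp [stdRow, Finset.sum_add_distrib]

theorem sum_stdRow_mul (m : ℕ) (p q : V) (f : V → ℝ) :
    ∑ u, (stdRow m p q u : ℝ) * f u = m * f p + f q := by
  simp [stdRow, add_mul, Finset.sum_add_distrib]

/-- The count is affine in the row of `z` with nonnegative coefficients; `p` and `q` carry the two
largest ones. -/
theorem exists_stdRow_ge [Nontrivial V] {M : V → V → ℕ} {m : ℕ} (t : V) {A : Finset V} (v : V)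
    {z : V} (hsum : ∑ u ∈ A, M z u ≤ m + 1) (hent : ∀ u ∈ A, M z u ≤ m) :
    ∃ p q, p ≠ q ∧
      pathCount M t A v ≤ pathCount (Function.update M z (stdRow m p q)) t A v := by
  obtain ⟨R, T, h0, -, hA, h⟩ := exists_affine_row M t A v z
  obtain ⟨y, -, hy⟩ := Finset.exists_max_image Finset.univ T ⟨z, Finset.mem_univ _⟩
  obtain ⟨w, hw⟩ := exists_ne y
  obtain ⟨q, hq, hq'⟩ := Finset.exists_max_image (Finset.univ.erase y) T ⟨w, by simpa using hw⟩
  refine ⟨y, q, (Finset.ne_of_mem_erase hq).symm, ?_⟩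
  have h1 := h (M z)
  rw [Function.update_eq_self] at h1
  rw [h1, h, sum_stdRow_mul, add_le_add_iff_left,
    ← Finset.sum_subset (Finset.subset_univ A) fun u _ hu => by rw [hA u hu, mul_zero]]
  by_cases hyA : y ∈ A
  · exact sum_mul_le_of_le hsum hent hyA (h0 q) (hy q (Finset.mem_univ _))
      fun u _ hu => hq' u (by simpa using hu)
  · rw [Finset.sum_eq_zero]
    · exact add_nonneg (mul_nonneg (Nat.cast_nonneg _) (h0 _)) (h0 _)
    · intro u _
      have h2 : T u = 0 := le_antisymm ((hy u (Finset.mem_univ _)).trans (hA y hyA).le) (h0 u)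
      rw [h2, mul_zero]

/-- Without a cap on the entries, everything goes to the largest coefficient. The coefficient at `z`
itself is zero, so `y ≠ z` costs nothing. -/
theorem exists_single_row_ge {M : V → V → ℕ} {c : ℕ} (t : V) {A : Finset V} (v : V)
    {z : V} (hne : (A.erase z).Nonempty) (hsum : ∑ u ∈ A, M z u ≤ c) :
    ∃ y ∈ A, y ≠ z ∧
      pathCount M t A v ≤ pathCount (Function.update M z (Pi.single y c)) t A v := by
  obtain ⟨R, T, h0, hz, hA, h⟩ := exists_affine_row M t A v z
  obtain ⟨y, hy, hy'⟩ := Finset.exists_max_image (A.erase z) T hne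
  rw [Finset.mem_erase] at hy
  refine ⟨y, hy.2, hy.1, ?_⟩
  have h1 := h (M z)
  rw [Function.update_eq_self] at h1
  rw [h1, h, add_le_add_iff_left,
    ← Finset.sum_subset (Finset.subset_univ A) fun u _ hu => by rw [hA u hu, mul_zero]]
  have h2 : ∀ u ∈ A, T u ≤ T y := by
    intro u hu
    by_cases huz : u = z
    · rw [huz, hz]; exact h0 y
    · exact hy' u (Finset.mem_erase.2 ⟨huz, hu⟩)
  have h3 : ∑ u, ((Pi.single y c : V → ℕ) u : ℝ) * T u = c * T y := by
    rw [Finset.sum_eq_single y]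
    · simp
    · intro u _ hu; simp [hu]
    · simp
  rw [h3]
  calc ∑ u ∈ A, (M z u : ℝ) * T u ≤ ∑ u ∈ A, (M z u : ℝ) * T y :=
        Finset.sum_le_sum fun u hu => mul_le_mul_of_nonneg_left (h2 u hu) (Nat.cast_nonneg _)
    _ = ((∑ u ∈ A, M z u : ℕ) : ℝ) * T y := by rw [Nat.cast_sum, Finset.sum_mul]
    _ ≤ c * T y := mul_le_mul_of_nonneg_right (by exact_mod_cast hsum) (h0 y)

/-- Inside `A`, every vertex of `S` other than `x` has all its out-neighbours in `S`, and it has at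
most `d v` ways of going to `x`. -/
structure IsAbsorbing (M : V → V → ℕ) (t : V) (A S : Finset V) (x : V) (d : V → ℝ) : Prop where
  subset : S ⊆ A
  mem : x ∈ S
  target : t ∈ S → t = x
  nonneg : ∀ v ∈ S, 0 ≤ d v
  one_le : 1 ≤ d x
  out : ∀ v ∈ S, v ≠ x → ∀ u ∈ A, u ∉ S → M v u = 0
  sum_le : ∀ v ∈ S, v ≠ x → ∑ u ∈ S, (M v u : ℝ) * d u ≤ d v

/-- All edges from outside `S` to `S` are redirected to `x`. -/
def redirect (M : V → V → ℕ) (S : Finset V) (x : V) (w u : V) : ℕ :=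
  if w ∉ S ∧ u = x then ∑ y ∈ S, M w y else M w u

namespace IsAbsorbing

variable {M : V → V → ℕ} {t : V} {A S : Finset V} {x : V} {d : V → ℝ}

/-- The only way out of `S` is through `x`, and `t` lies in `S` only as `x`; once `x` is gone, a
path in `S` is trapped. -/
theorem pathCount_eq_zero (h : IsAbsorbing M t A S x d) {B : Finset V} (hB : B ⊆ A) (hx : x ∉ B)
    {v : V} (hv : v ∈ S) : pathCount M t B v = 0 := by
  induction B using Finset.strongInduction generalizing v with
  | H B ih =>
    by_cases hvB : v ∈ B
    swap
    · exact pathCount_of_notMem hvB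
    have hvx : v ≠ x := by rintro rfl; exact hx hvB
    have hvt : v ≠ t := by rintro rfl; exact hvx (h.target hv)
    rw [pathCount_step hvB hvt]
    refine Finset.sum_eq_zero fun u _ => ?_
    by_cases hu : u ∈ B
    · by_cases huS : u ∈ S
      · rw [ih _ (Finset.erase_ssubset hvB) ((Finset.erase_subset _ _).trans hB)
          (fun hh => hx (Finset.mem_of_mem_erase hh)) huS, mul_zero]
      · rw [h.out v hv hvx u (hB hu) huS, Nat.cast_zero, zero_mul]
    · rw [pathCount_of_notMem fun hh => hu (Finset.mem_of_mem_erase hh), mul_zero]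

theorem pathCount_eq_sdiff (h : IsAbsorbing M t A S x d) {B : Finset V} (hB : B ⊆ A) (hx : x ∉ B)
    {v : V} (hv : v ∉ S) :
    pathCount M t B v = pathCount (redirect M S x) t (B \ S) v := by
  induction B using Finset.strongInduction generalizing v with
  | H B ih =>
    by_cases hvB : v ∈ B
    swap
    · rw [pathCount_of_notMem hvB, pathCount_of_notMem (by simp [hvB])]
    have hvB' : v ∈ B \ S := Finset.mem_sdiff.2 ⟨hvB, hv⟩
    by_cases hvt : v = t
    · subst hvt; rw [pathCount_target hvB, pathCount_target hvB']
    have e : (B \ S).erase v = B.erase v \ S := by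
      ext w; simp only [Finset.mem_sdiff, Finset.mem_erase]; tauto
    rw [pathCount_step hvB hvt, pathCount_step hvB' hvt, e]
    refine Finset.sum_congr rfl fun u _ => ?_
    have hx' : x ∉ B.erase v := fun hh => hx (Finset.mem_of_mem_erase hh)
    have hB' : B.erase v ⊆ A := (Finset.erase_subset _ _).trans hB
    by_cases huS : u ∈ S
    · rw [h.pathCount_eq_zero hB' hx' huS, pathCount_of_notMem (by simp [huS]), mul_zero, mul_zero]
    · rw [ih _ (Finset.erase_ssubset hvB) hB' hx' huS, redirect, if_neg]
      rintro ⟨-, rfl⟩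
      exact huS h.mem

/-- A path starting in `S` must first reach `x`, in at most `d v` ways; after `x` the set `S` is a
dead end, so the rest is a path in the contracted graph. -/
theorem pathCount_le_mul (h : IsAbsorbing M t A S x d) {B : Finset V} (hB : B ⊆ A) (hx : x ∈ B)
    {v : V} (hv : v ∈ S) :
    pathCount M t B v ≤ d v * pathCount (redirect M S x) t (insert x (B \ S)) x := by
  have hx' : x ∈ insert x (B \ S) := Finset.mem_insert_self _ _
  induction B using Finset.strongInduction generalizing v with
  | H B ih =>
    by_cases hvx : v = x
    · subst hvx
      refine le_trans ?_ (le_mul_of_one_le_left (pathCount_nonneg _ _ _ _) h.one_le)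
      by_cases hvt : v = t
      · subst hvt; rw [pathCount_target hx, pathCount_target hx']
      · rw [pathCount_step hx hvt, pathCount_step hx' hvt,
          Finset.erase_insert (by simp [hv])]
        refine Finset.sum_le_sum fun u _ => ?_
        have hB' : B.erase v ⊆ A := (Finset.erase_subset _ _).trans hB
        by_cases huS : u ∈ S
        · rw [h.pathCount_eq_zero hB' (by simp) huS, mul_zero]
          exact mul_nonneg (Nat.cast_nonneg _) (pathCount_nonneg _ _ _ _)
        · rw [h.pathCount_eq_sdiff hB' (by simp) huS, redirect, if_neg (by simp [hv])]
          have : B.erase v \ S = B \ S := by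
            ext w; simp only [Finset.mem_sdiff, Finset.mem_erase]
            exact ⟨fun hh => ⟨hh.1.2, hh.2⟩, fun hh => ⟨⟨by rintro rfl; exact hh.2 hv, hh.1⟩, hh.2⟩⟩
          rw [this]
    · have hvt : v ≠ t := by rintro rfl; exact hvx (h.target hv)
      by_cases hvB : v ∈ B
      · rw [pathCount_step hvB hvt]
        have e : B.erase v \ S = B \ S := by
          ext w; simp only [Finset.mem_sdiff, Finset.mem_erase]
          exact ⟨fun hh => ⟨hh.1.2, hh.2⟩, fun hh => ⟨⟨by rintro rfl; exact hh.2 hv, hh.1⟩, hh.2⟩⟩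
        have hB' : B.erase v ⊆ A := (Finset.erase_subset _ _).trans hB
        have h1 : ∑ u, (M v u : ℝ) * pathCount M t (B.erase v) u ≤
            ∑ u ∈ S, (M v u : ℝ) *
              (d u * pathCount (redirect M S x) t (insert x (B \ S)) x) := by
          rw [← Finset.sum_subset (Finset.subset_univ S)]
          · refine Finset.sum_le_sum fun u hu => ?_
            have := ih _ (Finset.erase_ssubset hvB) hB'
              (Finset.mem_erase.2 ⟨Ne.symm hvx, hx⟩) hu (Finset.mem_insert_self _ _)
            rw [e] at this
            exact mul_le_mul_of_nonneg_left this (Nat.cast_nonneg _)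
          · intro u _ hu
            by_cases huA : u ∈ A
            · rw [h.out v hv hvx u huA hu, Nat.cast_zero, zero_mul]
            · rw [pathCount_of_notMem fun hh => huA (hB' hh), mul_zero]
        refine h1.trans ?_
        simp_rw [← mul_assoc]
        rw [← Finset.sum_mul]
        exact mul_le_mul_of_nonneg_right (h.sum_le v hv hvx) (pathCount_nonneg _ _ _ _)
      · rw [pathCount_of_notMem hvB]
        exact mul_nonneg (h.nonneg v hv) (pathCount_nonneg _ _ _ _)

/-- A useful path enters `S` at most once, then runs to `x`. The redirected edge to `x` collects all
edges into `S`, and `D` pays for the way inside. -/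
theorem pathCount_le_mul_of_notMem (h : IsAbsorbing M t A S x d) {D : ℝ} (hD : ∀ u ∈ S, d u ≤ D)
    {B : Finset V} (hB : B ⊆ A) (hx : x ∈ B) {v : V} (hv : v ∉ S) :
    pathCount M t B v ≤ D * pathCount (redirect M S x) t (insert x (B \ S)) v := by
  have hD1 : 1 ≤ D := h.one_le.trans (hD x h.mem)
  have hD0 : 0 ≤ D := zero_le_one.trans hD1
  induction B using Finset.strongInduction generalizing v with
  | H B ih =>
    by_cases hvB : v ∈ B
    swap
    · rw [pathCount_of_notMem hvB]
      exact mul_nonneg hD0 (pathCount_nonneg _ _ _ _)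
    have hvx : v ≠ x := by rintro rfl; exact hv h.mem
    have hvB' : v ∈ insert x (B \ S) := by simp [hvB, hv]
    by_cases hvt : v = t
    · subst hvt; rw [pathCount_target hvB, pathCount_target hvB', mul_one]; exact hD1
    have hB' : B.erase v ⊆ A := (Finset.erase_subset _ _).trans hB
    have hx' : x ∈ B.erase v := Finset.mem_erase.2 ⟨Ne.symm hvx, hx⟩
    have e : (insert x (B \ S)).erase v = insert x (B.erase v \ S) := by
      ext w; simp only [Finset.mem_sdiff, Finset.mem_erase, Finset.mem_insert]
      constructor
      · rintro ⟨h1, h2 | h2⟩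
        · exact Or.inl h2
        · exact Or.inr ⟨⟨h1, h2.1⟩, h2.2⟩
      · rintro (h1 | h1)
        · exact ⟨h1 ▸ Ne.symm hvx, Or.inl h1⟩
        · exact ⟨h1.1.1, Or.inr ⟨h1.1.2, h1.2⟩⟩
    rw [pathCount_step hvB hvt, pathCount_step hvB' hvt, e]
    set F := pathCount (redirect M S x) t (insert x (B.erase v \ S)) with hF
    have hF0 : ∀ u, 0 ≤ F u := fun u => pathCount_nonneg _ _ _ _
    have h1 : ∀ u ∈ S, (M v u : ℝ) * pathCount M t (B.erase v) u ≤ M v u * (D * F x) :=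
      fun u hu => mul_le_mul_of_nonneg_left ((h.pathCount_le_mul hB' hx' hu).trans
        (mul_le_mul_of_nonneg_right (hD u hu) (hF0 x))) (Nat.cast_nonneg _)
    have h2 : ∀ u ∈ Sᶜ, (M v u : ℝ) * pathCount M t (B.erase v) u ≤
        D * (redirect M S x v u * F u) := fun u hu => by
      rw [Finset.mem_compl] at hu
      have hux : u ≠ x := by rintro rfl; exact hu h.mem
      rw [redirect, if_neg (fun hh => hux hh.2), mul_left_comm]
      exact mul_le_mul_of_nonneg_left (ih _ (Finset.erase_ssubset hvB) hB' hx' hu)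
        (Nat.cast_nonneg _)
    have h3 : D * (redirect M S x v x * F x) ≤ ∑ u ∈ S, D * (redirect M S x v u * F u) :=
      Finset.single_le_sum (f := fun u => D * ((redirect M S x v u : ℝ) * F u))
        (fun u _ => mul_nonneg hD0 (mul_nonneg (Nat.cast_nonneg _) (hF0 u))) h.mem
    rw [← Finset.sum_add_sum_compl S, Finset.mul_sum, ← Finset.sum_add_sum_compl S]
    refine add_le_add ((Finset.sum_le_sum h1).trans (le_trans (le_of_eq ?_) h3))
      (Finset.sum_le_sum h2)
    rw [redirect, if_pos ⟨hv, rfl⟩, ← Finset.sum_mul, Nat.cast_sum]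
    ring

end IsAbsorbing

end Absorption

/-! ### Vertex weights and the growth of absorbing sets. -/

section Weight

variable {V : Type*} [Fintype V] [DecidableEq V]

/-- On `A`, the entries of the row are at most `m` and their sum is at most `c`. -/
structure RowBound (m : ℕ) (A : Finset V) (row : V → ℕ) (c : ℕ) : Prop where
  one_le : 1 ≤ c
  le : c ≤ m + 1
  sum_le : ∑ u ∈ A, row u ≤ c
  entry_le : ∀ u ∈ A, row u ≤ m

omit [Fintype V] [DecidableEq V] in
theorem RowBound.mono {m : ℕ} {A B : Finset V} {row : V → ℕ} {c : ℕ} (h : RowBound m A row c)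
    (hB : B ⊆ A) : RowBound m B row c :=
  ⟨h.one_le, h.le, (Finset.sum_le_sum_of_subset hB).trans h.sum_le, fun u hu => h.entry_le u (hB hu)⟩

/-- The contribution of a vertex of outdegree at most `c` to the bound on the number of paths. -/
noncomputable def vertexWeight (m : ℕ) (a : ℝ) (c : ℕ) : ℝ := if c ≤ m then (m * c + 1) / a else a

variable {m : ℕ} {a : ℝ}

theorem le_root (ha : 0 < a) (haa : a ^ 2 = m * a + 1) : (m : ℝ) < a := by
  by_contra h
  nlinarith

theorem root_le (hm : 1 ≤ m) (ha : 0 < a) (haa : a ^ 2 = m * a + 1) : a ≤ m + 1 := by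
  have : (1 : ℝ) ≤ m := by exact_mod_cast hm
  have := le_root ha haa
  by_contra h
  nlinarith

theorem one_le_root (hm : 1 ≤ m) (ha : 0 < a) (haa : a ^ 2 = m * a + 1) : 1 ≤ a := by
  have : (1 : ℝ) ≤ m := by exact_mod_cast hm
  have := le_root ha haa
  linarith

theorem one_le_vertexWeight (hm : 1 ≤ m) (ha : 0 < a) (haa : a ^ 2 = m * a + 1) {c : ℕ}
    (hc : 1 ≤ c) : 1 ≤ vertexWeight m a c := by
  rw [vertexWeight]
  split_ifs with h
  · rw [le_div_iff₀ ha, one_mul]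
    have h1 : (1 : ℝ) ≤ c := by exact_mod_cast hc
    have h2 := root_le hm ha haa
    nlinarith [(Nat.cast_nonneg m : (0:ℝ) ≤ m)]
  · exact one_le_root hm ha haa

omit [Fintype V] in
theorem sum_mul_le_root {M : V → ℕ} {S : Finset V} {d : V → ℝ} {K : ℝ} (ha : 0 < a)
    (haa : a ^ 2 = m * a + 1) (hsum : ∑ u ∈ S, M u ≤ m + 1) (hent : ∀ u ∈ S, M u ≤ m)
    (h0 : ∀ u ∈ S, 0 ≤ d u) (hK0 : 0 ≤ K) (hK : ∀ u ∈ S, d u ≤ K)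
    (hpair : ∀ y ∈ S, ∀ y' ∈ S, y ≠ y' → m * d y + d y' ≤ a * K) :
    ∑ u ∈ S, (M u : ℝ) * d u ≤ a * K := by
  have hma := le_root ha haa
  rcases S.eq_empty_or_nonempty with rfl | hne
  · simp only [Finset.sum_empty]; positivity
  obtain ⟨y, hy, hy'⟩ := Finset.exists_max_image S d hne
  rcases (S.erase y).eq_empty_or_nonempty with he | hne'
  · refine (sum_mul_le_of_le hsum hent hy le_rfl (h0 y hy) fun u hu huy => ?_).trans ?_
    · have : u ∈ S.erase y := Finset.mem_erase.2 ⟨huy, hu⟩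
      simp [he] at this
    · rw [add_zero]
      exact mul_le_mul hma.le (hK y hy) (h0 y hy) ha.le
  · obtain ⟨q, hq, hq'⟩ := Finset.exists_max_image (S.erase y) d hne'
    rw [Finset.mem_erase] at hq
    exact (sum_mul_le_of_le hsum hent hy (h0 q hq.2) (hy' q hq.2) fun u hu huy =>
      hq' u (Finset.mem_erase.2 ⟨huy, hu⟩)).trans (hpair y hy q hq.2 (Ne.symm hq.1))

/-- One step of the growth of an absorbing set. -/
theorem absorbing_step (hm : 1 ≤ m) (ha : 0 < a) (haa : a ^ 2 = m * a + 1) {K e : ℝ} {c : ℕ}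
    (hc : 1 ≤ c) (hK : 0 ≤ K) (h1 : c ≤ m → e ≤ c * K) (h2 : e ≤ a * K) :
    e ≤ vertexWeight m a c * K ∧ a * K ≤ a * (vertexWeight m a c * K) ∧
      m * e + K ≤ a * (vertexWeight m a c * K) ∧ m * K + e ≤ a * (vertexWeight m a c * K) := by
  have hm' : (1 : ℝ) ≤ m := by exact_mod_cast hm
  have hma := le_root ha haa
  have hma' := root_le hm ha haa
  have hc' : (1 : ℝ) ≤ c := by exact_mod_cast hc
  have hw := one_le_vertexWeight hm ha haa hc
  have h3 : a * K ≤ a * (vertexWeight m a c * K) :=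
    mul_le_mul_of_nonneg_left (le_mul_of_one_le_left hK hw) ha.le
  by_cases hcm : c ≤ m
  · have h1 := h1 hcm
    have hcm' : (c : ℝ) ≤ m := by exact_mod_cast hcm
    have h4 : a * (vertexWeight m a c * K) = (m * c + 1) * K := by
      rw [vertexWeight, if_pos hcm]; field_simp
    refine ⟨?_, h3, ?_, ?_⟩
    · rw [← mul_le_mul_iff_right₀ ha, h4]
      refine (mul_le_mul_of_nonneg_left h1 ha.le).trans ?_
      rw [← mul_assoc]
      refine mul_le_mul_of_nonneg_right ?_ hK
      nlinarith
    -- This inequality dictates the weight `(m * c + 1) / a`: it is an equality when `e = c * K`.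
    · rw [h4]; nlinarith
    · rw [h4]
      have : ((m : ℝ) + c) * K ≤ (m * c + 1) * K :=
        mul_le_mul_of_nonneg_right (by nlinarith) hK
      linarith
  · have h4 : vertexWeight m a c = a := by rw [vertexWeight, if_neg hcm]
    rw [h4] at h3 ⊢
    -- For `c = m + 1` the extreme value is `e = a * K`, and the equation of `a` makes the weight
    -- `a` exactly sufficient.
    have h5 : a * (a * K) = m * a * K + K := by rw [← mul_assoc, ← sq, haa]; ring
    refine ⟨h2, h3, ?_, ?_⟩
    · rw [h5]; nlinarith
    · rw [h5]
      have h6 : ((m : ℝ) + a) * K ≤ (m * a + 1) * K :=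
        mul_le_mul_of_nonneg_right (by nlinarith) hK
      linarith

-- A set of maximal size is taken among those satisfying, besides the cap `K` on `d`, the pair
-- condition `m * d y + d y' ≤ a * K`. That condition lets a vertex of outdegree `m + 1` join at
-- cost `a` instead of `m + 1`, and `absorbing_step` preserves it. A vertex with no out-neighbour in
-- `A` outside `S` could be added, so by maximality none other than `t` remains.
omit [Fintype V] in
theorem exists_isAbsorbing {M : V → V → ℕ} {t : V} {A : Finset V} {c : V → ℕ} {x : V} (hm : 1 ≤ m)
    (ha : 0 < a) (haa : a ^ 2 = m * a + 1)
    (hM : ∀ v ∈ A, v ≠ t → RowBound m A (M v) (c v)) (hx : x ∈ A) :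
    ∃ S d, IsAbsorbing M t A S x d ∧
      (∀ u ∈ S, d u ≤ ∏ v ∈ S.erase x, vertexWeight m a (c v)) ∧
      ∀ w ∈ A, w ∉ S → w ≠ t → ∃ u ∈ A, u ∉ S ∧ M w u ≠ 0 := by
  classical
  let good : Finset V → Prop := fun S => ∃ d, IsAbsorbing M t A S x d ∧
      (∀ u ∈ S, d u ≤ ∏ v ∈ S.erase x, vertexWeight m a (c v)) ∧
      ∀ y ∈ S, ∀ y' ∈ S, y ≠ y' → m * d y + d y' ≤ a * ∏ v ∈ S.erase x, vertexWeight m a (c v)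
  have h0 : good {x} := by
    refine ⟨fun _ => 1, ⟨by simpa using hx, by simp, by simp, by simp, le_rfl, by simp,
      by simp⟩, by simp, ?_⟩
    intro y hy y' hy' hne
    rw [Finset.mem_singleton] at hy hy'
    exact absurd (hy.trans hy'.symm) hne
  obtain ⟨S, hS, hmax⟩ := Finset.exists_max_image (A.powerset.filter good) Finset.card
    ⟨{x}, by simp [h0, hx]⟩
  rw [Finset.mem_filter] at hS
  obtain ⟨d, hd, hdK, hpair⟩ := hS.2
  refine ⟨S, d, hd, hdK, fun w hwA hwS hwt => ?_⟩
  by_contra hcon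
  push Not at hcon
  have hwx : w ≠ x := by rintro rfl; exact hwS hd.mem
  set K := ∏ v ∈ S.erase x, vertexWeight m a (c v) with hKdef
  have hK0 : 0 ≤ K := Finset.prod_nonneg fun v hv => by
    have hv' := Finset.mem_erase.1 hv
    have hvt : v ≠ t := by rintro rfl; exact hv'.1 (hd.target hv'.2)
    exact zero_le_one.trans (one_le_vertexWeight hm ha haa (hM v (hd.subset hv'.2) hvt).one_le)
  have hr := hM w hwA hwt
  have hrS := hr.mono hd.subset
  set e := ∑ u ∈ S, (M w u : ℝ) * d u with he
  have he0 : 0 ≤ e := Finset.sum_nonneg fun u hu => mul_nonneg (Nat.cast_nonneg _) (hd.nonneg u hu)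
  obtain ⟨k1, k2, k3, k4⟩ := absorbing_step hm ha haa (K := K) (e := e) hr.one_le hK0
    (fun _ => by
      calc e ≤ ∑ u ∈ S, (M w u : ℝ) * K := Finset.sum_le_sum fun u hu =>
            mul_le_mul_of_nonneg_left (hdK u hu) (Nat.cast_nonneg _)
        _ = ((∑ u ∈ S, M w u : ℕ) : ℝ) * K := by rw [Nat.cast_sum, Finset.sum_mul]
        _ ≤ c w * K := mul_le_mul_of_nonneg_right (by exact_mod_cast hrS.sum_le) hK0)
    (sum_mul_le_root ha haa (hrS.sum_le.trans hr.le) hrS.entry_le hd.nonneg hK0 hdK hpair)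
  have hprod : ∏ v ∈ (insert w S).erase x, vertexWeight m a (c v) = vertexWeight m a (c w) * K := by
    rw [Finset.erase_insert_of_ne hwx, Finset.prod_insert (by simp [hwS])]
  have hKK : K ≤ vertexWeight m a (c w) * K :=
    le_mul_of_one_le_left hK0 (one_le_vertexWeight hm ha haa hr.one_le)
  have hdw : ∀ u ∈ S, Function.update d w e u = d u := fun u hu =>
    Function.update_of_ne (by rintro rfl; exact hwS hu) _ _
  have hsumS : ∀ r : V → ℕ, ∑ u ∈ S, (r u : ℝ) * Function.update d w e u =
      ∑ u ∈ S, (r u : ℝ) * d u := fun r => Finset.sum_congr rfl fun u hu => by rw [hdw u hu]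
  have hww : M w w = 0 := hcon w hwA hwS
  have hgood : good (insert w S) := by
    refine ⟨Function.update d w e, ⟨?_, ?_, ?_, ?_, ?_, ?_, ?_⟩, ?_, ?_⟩
    · exact Finset.insert_subset hwA hd.subset
    · exact Finset.mem_insert_of_mem hd.mem
    · intro ht
      rcases Finset.mem_insert.1 ht with rfl | ht
      · exact absurd rfl hwt
      · exact hd.target ht
    · intro v hv
      rcases Finset.mem_insert.1 hv with rfl | hv
      · simpa using he0
      · rw [hdw v hv]; exact hd.nonneg v hv
    · rw [hdw x hd.mem]; exact hd.one_le
    · intro v hv hvx u hu huS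
      rw [Finset.mem_insert, not_or] at huS
      rcases Finset.mem_insert.1 hv with rfl | hv
      · exact hcon u hu huS.2
      · exact hd.out v hv hvx u hu huS.2
    · intro v hv hvx
      rw [Finset.sum_insert hwS, hsumS]
      rcases Finset.mem_insert.1 hv with rfl | hv
      · simp [hww, he]
      · rw [hd.out v hv hvx w hwA hwS, hdw v hv, Nat.cast_zero, zero_mul, zero_add]
        exact hd.sum_le v hv hvx
    · intro u hu
      rw [hprod]
      rcases Finset.mem_insert.1 hu with rfl | hu
      · simpa using k1
      · rw [hdw u hu]; exact (hdK u hu).trans hKK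
    · intro y hy y' hy' hne
      rw [hprod]
      rcases Finset.mem_insert.1 hy with h5 | h5 <;> rcases Finset.mem_insert.1 hy' with h6 | h6
      · exact absurd (h5.trans h6.symm) hne
      · rw [h5, hdw y' h6, Function.update_self]
        linarith [hdK y' h6]
      · rw [h6, hdw y h5, Function.update_self]
        linarith [mul_le_mul_of_nonneg_left (hdK y h5) (Nat.cast_nonneg (α := ℝ) m)]
      · rw [hdw y h5, hdw y' h6]
        exact (hpair y h5 y' h6 hne).trans k2
  have := hmax (insert w S) (by
    rw [Finset.mem_filter, Finset.mem_powerset]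
    exact ⟨Finset.insert_subset hwA hd.subset, hgood⟩)
  rw [Finset.card_insert_of_notMem hwS] at this
  omega

end Weight

/-! ### The inductive statement and its numerical consequences. -/

section Bound

variable {V : Type*} [Fintype V] [DecidableEq V] {m : ℕ} {a : ℝ}

/-- The number of paths to `t` inside `A` is at most the product of the weights of the vertices. -/
def PathBound (m : ℕ) (a : ℝ) (t : V) (A : Finset V) : Prop :=
  ∀ (M : V → V → ℕ) (c : V → ℕ) (s : V),
    (∀ v ∈ A, v ≠ t → RowBound m (A.erase s) (M v) (c v)) →
    pathCount M t A s ≤ ∏ v ∈ A.erase t, vertexWeight m a (c v)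

/-- Vertices of `U` have lost an edge, for instance one into the start, and weigh `(m ^ 2 + 1) / a`
instead of `a`: each saves the factor `(m ^ 2 + 1) / a ^ 2`. -/
theorem PathBound.le_of_subset {t : V} {A : Finset V} (h : PathBound m a t A) (hm : 1 ≤ m)
    (ha : 0 < a) {M : V → V → ℕ} {s : V} {U : Finset V} (hU : U ⊆ A.erase t)
    (hent : ∀ v ∈ A, v ≠ t → ∀ u, M v u ≤ m)
    (hsum : ∀ v ∈ A, v ≠ t → ∑ u ∈ A.erase s, M v u ≤ m + 1)
    (hsumU : ∀ v ∈ U, ∑ u ∈ A.erase s, M v u ≤ m) :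
    pathCount M t A s ≤ ((m ^ 2 + 1) / a ^ 2) ^ U.card * a ^ (A.erase t).card := by
  refine (h M (fun v => if v ∈ U then m else m + 1) s fun v hv hvt => ?_).trans (le_of_eq ?_)
  · refine ⟨by split_ifs <;> omega, by split_ifs <;> omega, ?_, fun u _ => hent v hv hvt u⟩
    split_ifs with hvU
    · exact hsumU v hvU
    · exact hsum v hv hvt
  · have h1 : ∀ v ∈ A.erase t, vertexWeight m a (if v ∈ U then m else m + 1) =
        (if v ∈ U then ((m : ℝ) ^ 2 + 1) / a ^ 2 else 1) * a := by
      intro v _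
      split_ifs
      · rw [vertexWeight, if_pos le_rfl]; field_simp
      · rw [vertexWeight, if_neg (by omega), one_mul]
    rw [Finset.prod_congr rfl h1, Finset.prod_mul_distrib, Finset.prod_const, Finset.prod_ite,
      Finset.prod_const, Finset.prod_const_one, mul_one, Finset.filter_mem_eq_inter,
      Finset.inter_eq_right.2 hU]

theorem PathBound.le_of_one {t : V} {A : Finset V} (h : PathBound m a t A) (hm : 1 ≤ m)
    (ha : 0 < a) {M : V → V → ℕ} {s z : V} (hz : z ∈ A.erase t)
    (hent : ∀ v ∈ A, v ≠ t → ∀ u, M v u ≤ m)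
    (hsum : ∀ v ∈ A, v ≠ t → ∑ u ∈ A.erase s, M v u ≤ m + 1)
    (hsumz : ∑ u ∈ A.erase s, M z u ≤ 1) :
    pathCount M t A s ≤ (m + 1) / a ^ 2 * a ^ (A.erase t).card := by
  refine (h M (fun v => if v = z then 1 else m + 1) s fun v hv hvt => ?_).trans (le_of_eq ?_)
  · refine ⟨by split_ifs <;> omega, by split_ifs <;> omega, ?_, fun u _ => hent v hv hvt u⟩
    split_ifs with hvz
    · rw [hvz]; exact hsumz
    · exact hsum v hv hvt
  · have h1 : ∀ v ∈ A.erase t, vertexWeight m a (if v = z then 1 else m + 1) =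
        (if v = z then ((m : ℝ) + 1) / a ^ 2 else 1) * a := by
      intro v _
      split_ifs
      · rw [vertexWeight, if_pos hm]; push_cast; field_simp
      · rw [vertexWeight, if_neg (by omega), one_mul]
    rw [Finset.prod_congr rfl h1, Finset.prod_mul_distrib, Finset.prod_const, Finset.prod_ite_eq',
      if_pos hz]

theorem root_cube (haa : a ^ 2 = m * a + 1) : a ^ 3 = (m ^ 2 + 1) * a + m := by
  have : a ^ 3 = a * a ^ 2 := by ring
  rw [this, haa, mul_add, mul_left_comm, ← sq, haa]; ring

/-- Writing `κ` for the base on the left, `κ * a ^ 2 = m ^ 2 + 1`, so this is the case `r = 0` of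
`weight_pow_mul_le`. -/
theorem weight_sq_le (hm : 1 ≤ m) (ha : 0 < a) (haa : a ^ 2 = m * a + 1) :
    (((m : ℝ) ^ 2 + 1) / a ^ 2) ^ 2 ≤ a ^ 2 - (m ^ 2 + 1) := by
  have hm' : (1 : ℝ) ≤ m := by exact_mod_cast hm
  have h1 := root_le hm ha haa
  have h4 : a ^ 4 = (m ^ 3 + 2 * m) * a + (m ^ 2 + 1) := by
    have : a ^ 4 = a * a ^ 3 := by ring
    rw [this, root_cube haa]
    linear_combination ((m : ℝ) ^ 2 + 1) * haa
  have h5 : (a ^ 2 - (m ^ 2 + 1)) * a = m := by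
    linear_combination root_cube haa
  rw [div_pow, div_le_iff₀ (by positivity), ← mul_le_mul_iff_left₀ ha]
  have h6 : (a ^ 2 - ((m : ℝ) ^ 2 + 1)) * (a ^ 2) ^ 2 * a = m * a ^ 4 := by
    linear_combination a ^ 4 * h5
  rw [h6, h4]
  nlinarith [pow_pos (zero_lt_one.trans_le hm') 3]

/-- Each further in-neighbour adds 1 to the bracket but contributes another factor `κ ≤ 1`, which
more than compensates. -/
theorem weight_pow_mul_le (hm : 1 ≤ m) (ha : 0 < a) (haa : a ^ 2 = m * a + 1) (r : ℕ) :
    (((m : ℝ) ^ 2 + 1) / a ^ 2) ^ (r + 1) * (m * a + (m ^ 2 + 1) / a ^ 2 + (r + 1)) ≤ a ^ 2 := by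
  have hsq := weight_sq_le hm ha haa
  set κ := ((m : ℝ) ^ 2 + 1) / a ^ 2 with hκ
  have hκ0 : 0 < κ := by positivity
  have hκa : κ * a ^ 2 = m ^ 2 + 1 := by rw [hκ]; field_simp
  have hκ1 : κ ≤ 1 := by
    rw [hκ, div_le_one (by positivity)]
    nlinarith [sq_nonneg (((m : ℝ) ^ 2 + 1) / a ^ 2)]
  induction r with
  | zero =>
    simp only [zero_add, pow_one, Nat.cast_zero]
    nlinarith
  | succ r ih =>
    refine le_trans ?_ ih
    rw [pow_succ, mul_assoc]
    refine mul_le_mul_of_nonneg_left ?_ (by positivity)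
    push_cast
    have hr : (0 : ℝ) ≤ r := Nat.cast_nonneg r
    nlinarith [mul_nonneg (sub_nonneg.2 hκ1) hr]

end Bound

/-! ### Rows with `m` edges to one vertex and one edge to another. -/

section StdRow

variable {V : Type*} [DecidableEq V] {m : ℕ}

/-- The vertex has `m` edges to one vertex and one edge to another vertex. -/
def IsStdRow (m : ℕ) (row : V → ℕ) : Prop := ∃ p q, p ≠ q ∧ row = stdRow m p q

variable {row : V → ℕ}

theorem IsStdRow.sum_le (h : IsStdRow m row) (B : Finset V) : ∑ u ∈ B, row u ≤ m + 1 := by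
  obtain ⟨p, q, -, rfl⟩ := h
  rw [sum_stdRow]
  split_ifs <;> omega

theorem IsStdRow.le (h : IsStdRow m row) (hm : 1 ≤ m) (u : V) : row u ≤ m := by
  obtain ⟨p, q, hpq, rfl⟩ := h
  rw [stdRow]
  split_ifs with h1 h2 h2
  · exact absurd (h1.symm.trans h2) hpq
  all_goals omega

theorem IsStdRow.sum_le_of_ne_zero (h : IsStdRow m row) {B : Finset V} {u : V}
    (hu : row u ≠ 0) (huB : u ∉ B) : ∑ w ∈ B, row w ≤ m := by
  have h1 := h.sum_le (insert u B)
  rw [Finset.sum_insert huB] at h1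
  omega

theorem IsStdRow.sum_le_of_eq (h : IsStdRow m row) {B : Finset V} {u : V}
    (hu : row u = m) (huB : u ∉ B) : ∑ w ∈ B, row w ≤ 1 := by
  have h1 := h.sum_le (insert u B)
  rw [Finset.sum_insert huB] at h1
  omega

theorem IsStdRow.eq_one (h : IsStdRow m row) {u : V} (hu : row u ≠ 0) (hu' : row u ≠ m) :
    row u = 1 := by
  obtain ⟨p, q, hpq, rfl⟩ := h
  rw [stdRow] at *
  split_ifs at * with h1 h2 h2
  · exact absurd (h1.symm.trans h2) hpq
  all_goals omega

theorem IsStdRow.eq_of_eq_one (h : IsStdRow m row) (hm : 2 ≤ m) {u w : V} (hu : row u = 1)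
    (hw : row w = 1) : u = w := by
  obtain ⟨p, q, hpq, rfl⟩ := h
  rw [stdRow] at *
  split_ifs at * <;> first | omega | simp_all

end StdRow

/-! ### Two starting points with weights `m` and `1`. -/

section TwoSources

variable {V : Type*} [Fintype V] [DecidableEq V] {m : ℕ} {a : ℝ}

omit [Fintype V] [DecidableEq V] in
theorem le_root_cube (hm : 2 ≤ m) (ha : 0 < a) (haa : a ^ 2 = m * a + 1) :
    (m : ℝ) * (m + a) + (m ^ 2 + 1) ≤ a ^ 3 := by
  have hma := le_root ha haa
  rw [root_cube haa]
  have h6 : (2 * (m : ℝ) ^ 2 + 1 - m) ≤ (m ^ 2 - m + 1) * a := by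
    -- For `m = 2` the bound `m < a` is too weak and the quadratic equation is needed.
    rcases hm.eq_or_lt with h7 | h7
    · have e : (m : ℝ) = 2 := by exact_mod_cast h7.symm
      rw [e] at haa ⊢
      nlinarith
    · have e : (3 : ℝ) ≤ m := by exact_mod_cast h7
      have h8 : (0 : ℝ) ≤ m ^ 2 - m + 1 := by nlinarith
      have h9 := mul_le_mul_of_nonneg_left hma.le h8
      nlinarith [mul_nonneg (sub_nonneg.2 e) (sq_nonneg (m : ℝ))]
  linarith

-- Bounding both counts by `a ^ (H.erase t).card` gives the factor `m + 1`, which exceeds `a`, so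
-- something must be saved. If `p` or `q` has no in-edge from a usable vertex, the paths from the
-- other one avoid it. Otherwise in-edges of the start are useless and lower the weights of their
-- sources.
set_option maxHeartbeats 1000000 in
theorem two_sources_le (hm : 1 ≤ m) (ha : 0 < a) (haa : a ^ 2 = m * a + 1) {M : V → V → ℕ} {t : V}
    {H : Finset V} (hPB : ∀ B ⊆ H, PathBound m a t B)
    (hM : ∀ v ∈ H, v ≠ t → IsStdRow m (M v)) {p q : V} (hpq : p ≠ q) :
    m * pathCount M t H p + pathCount M t H q ≤ a ^ ((H.erase t).card + 1) := by
  have hm' : (1 : ℝ) ≤ m := by exact_mod_cast hm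
  have hma := le_root ha haa
  have hma' := root_le hm ha haa
  have ha1 := one_le_root hm ha haa
  have hcube := root_cube haa
  have hsub : ∀ B ⊆ H, ∀ v ∈ B, v ≠ t → IsStdRow m (M v) := fun B hB v hv => hM v (hB hv)
  have b0 : ∀ B ⊆ H, ∀ s, pathCount M t B s ≤ a ^ (B.erase t).card := fun B hB s => by
    have := (hPB B hB).le_of_subset hm ha (M := M) (s := s) (U := ∅) (Finset.empty_subset _)
      (fun v hv hvt => (hsub B hB v hv hvt).le hm)
      (fun v hv hvt => (hsub B hB v hv hvt).sum_le _) (by simp)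
    simpa using this
  rw [pow_succ']
  have hpow : 1 ≤ a ^ (H.erase t).card := one_le_pow₀ ha1
  by_cases hpH : p ∈ H
  swap
  · rw [pathCount_of_notMem hpH]
    nlinarith [b0 H subset_rfl q]
  by_cases hqH : q ∈ H
  swap
  · rw [pathCount_of_notMem hqH]
    nlinarith [b0 H subset_rfl p]
  by_cases hpt : p = t
  · subst hpt
    rw [pathCount_target hpH]
    have hN : (H.erase p).card ≠ 0 :=
      Finset.card_ne_zero_of_mem (Finset.mem_erase.2 ⟨Ne.symm hpq, hqH⟩)
    have h1 : a ≤ a ^ (H.erase p).card := le_self_pow₀ ha1 hN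
    nlinarith [b0 H subset_rfl q]
  by_cases hqt : q = t
  · subst hqt
    rw [pathCount_target hqH]
    have hN : (H.erase q).card ≠ 0 := Finset.card_ne_zero_of_mem (Finset.mem_erase.2 ⟨hpq, hpH⟩)
    obtain ⟨K, hK⟩ := Nat.exists_eq_succ_of_ne_zero hN
    have h2 := b0 H subset_rfl p
    rw [hK, pow_succ] at h2 ⊢
    have h3 : (1 : ℝ) ≤ a ^ K := one_le_pow₀ ha1
    have h4 : a * (a ^ K * a) = m * (a ^ K * a) + a ^ K := by
      linear_combination a ^ K * haa
    rw [h4]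
    nlinarith
  clear hpow
  have hHp : H.erase p ⊆ H := Finset.erase_subset _ _
  have hHq : H.erase q ⊆ H := Finset.erase_subset _ _
  have hHpq : (H.erase p).erase q ⊆ H := (Finset.erase_subset _ _).trans hHp
  have hcard : ∀ B : Finset V, ∀ w ∈ B, w ≠ t →
      (B.erase t).card = ((B.erase w).erase t).card + 1 := fun B w hw hwt => by
    rw [Finset.erase_right_comm, Finset.card_erase_add_one (Finset.mem_erase.2 ⟨hwt, hw⟩)]
  have c1 := hcard H p hpH hpt
  have c1' := hcard H q hqH hqt
  have c2 := hcard (H.erase p) q (Finset.mem_erase.2 ⟨Ne.symm hpq, hqH⟩) hqt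
  have bp := b0 H subset_rfl p
  have bq := b0 H subset_rfl q
  have b1 := b0 _ hHp
  have b1' := b0 _ hHq
  have b2 := b0 _ hHpq
  have cH : (H.erase t).card = (((H.erase p).erase q).erase t).card + 2 := by omega
  have cHp : ((H.erase p).erase t).card = (((H.erase p).erase q).erase t).card + 1 := by omega
  have cHq : ((H.erase q).erase t).card = (((H.erase p).erase q).erase t).card + 1 := by omega
  rw [cH, pow_add] at bp bq
  rw [cH]
  simp_rw [cHp, pow_succ] at b1
  simp_rw [cHq, pow_succ] at b1'
  set K := (((H.erase p).erase q).erase t).card with hK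
  set C := a ^ K with hC
  have hC0 : 0 < C := by positivity
  have hgoal : a * a ^ (K + 2) = a ^ 3 * C := by rw [hC]; ring
  rw [hgoal]
  -- Without such an edge, paths from `q` avoid `p` and lose a factor `a`; then `m * a ^ 2 + a = a ^
  -- 3` is just enough.
  by_cases hz : ∃ z ∈ H, z ≠ p ∧ z ≠ t ∧ M z p ≠ 0
  swap
  · push Not at hz
    have := (pathCount_le_erase_of_no_inEdge hpt (Ne.symm hpq) hz).trans (b1 q)
    have h3 : a ^ 3 = m * a ^ 2 + a := by linear_combination a * haa
    rw [h3]
    nlinarith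
  by_cases hy : ∃ y ∈ H, y ≠ q ∧ y ≠ t ∧ M y q ≠ 0
  swap
  · push Not at hy
    have := (pathCount_le_erase_of_no_inEdge hqt hpq hy).trans (b1' p)
    have h3 : (m : ℝ) * a + a ^ 2 ≤ a ^ 3 := by
      have : a ^ 3 = m * a ^ 2 + a := by linear_combination a * haa
      nlinarith [mul_nonneg (sub_nonneg.2 hm') (sub_nonneg.2 ha1)]
    nlinarith [mul_le_mul_of_nonneg_right h3 hC0.le]
  -- an in-edge of the start saves a factor
  have save : ∀ x z : V, z ∈ H → z ≠ t → M z x ≠ 0 →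
      pathCount M t H x ≤ (m ^ 2 + 1) * C := fun x z hz hzt hzx => by
    have := (hPB H subset_rfl).le_of_subset hm ha (M := M) (s := x) (U := {z})
      (by simp [hz, hzt]) (fun v hv hvt => (hM v hv hvt).le hm)
      (fun v hv hvt => (hM v hv hvt).sum_le _) (fun v hv => by
        rw [Finset.mem_singleton] at hv
        subst hv
        exact (hM v hz hzt).sum_le_of_ne_zero hzx (by simp))
    refine this.trans (le_of_eq ?_)
    rw [cH, Finset.card_singleton, pow_add, pow_one, ← hC]
    field_simp
  have saveBig : ∀ x z : V, z ∈ H → z ≠ t → M z x = m →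
      pathCount M t H x ≤ (m + 1) * C := fun x z hz hzt hzx => by
    have := (hPB H subset_rfl).le_of_one hm ha (M := M) (s := x) (z := z)
      (by simp [hz, hzt]) (fun v hv hvt => (hM v hv hvt).le hm)
      (fun v hv hvt => (hM v hv hvt).sum_le _) ((hM z hz hzt).sum_le_of_eq hzx (by simp))
    refine this.trans (le_of_eq ?_)
    rw [cH, pow_add, ← hC]
    field_simp
  obtain ⟨z, hzH, hzp, hzt, hzM⟩ := hz
  have sp := save p z hzH hzt hzM
  have sq' : pathCount M t H q ≤ (m ^ 2 + 1) * C := by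
    obtain ⟨y, hyH, hyq, hyt, hyM⟩ := hy
    exact save q y hyH hyt hyM
  rcases hm.eq_or_lt with hm1 | hm2
  · have e : (m : ℝ) = 1 := by exact_mod_cast hm1.symm
    rw [e] at haa hcube sp sq' ⊢
    have h8 : (3 / 2 : ℝ) ≤ a := by nlinarith
    have h3 : (4 : ℝ) ≤ a ^ 3 := by linarith
    have h9 := mul_le_mul_of_nonneg_right h3 hC0.le
    linarith
  have hm2' : (2 : ℝ) ≤ m := by exact_mod_cast hm2
  have ham : a * (a - m) = 1 := by linear_combination haa
  by_cases hbig : ∃ z ∈ H, z ≠ t ∧ M z p = m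
  · obtain ⟨z, hz, hzt, hzM⟩ := hbig
    have s := saveBig p z hz hzt hzM
    have h3 : (m : ℝ) * (m + 1) + a ^ 2 ≤ a ^ 3 := by nlinarith
    nlinarith [mul_le_mul_of_nonneg_right h3 hC0.le]
  by_cases hbig' : ∃ z ∈ H, z ≠ t ∧ M z q = m
  · obtain ⟨z, hz, hzt, hzM⟩ := hbig'
    have s := saveBig q z hz hzt hzM
    have h3 : (m : ℝ) * (m ^ 2 + 1) + (m + 1) ≤ a ^ 3 := by
      have : (1 : ℝ) ≤ (m ^ 2 + 1) * (a - m) := by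
        rw [← ham]
        exact mul_le_mul_of_nonneg_right (by nlinarith) (by linarith)
      nlinarith
    nlinarith [mul_le_mul_of_nonneg_right h3 hC0.le]
  push Not at hbig hbig'
  have hsmall : ∀ v ∈ H, v ≠ t → M v p ≠ 0 → M v p = 1 := fun v hv hvt h =>
    (hM v hv hvt).eq_one h (hbig v hv hvt)
  have hsmall' : ∀ v ∈ H, v ≠ t → M v q ≠ 0 → M v q = 1 := fun v hv hvt h =>
    (hM v hv hvt).eq_one h (hbig' v hv hvt)
  -- If `p` is the only usable in-neighbour of `q`, one step is taken from `p`: of its two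
  -- out-neighbours, `q` carries the single edge, and paths from the other, `p'`, avoid `q` because
  -- `p` has been left.
  by_cases hy' : ∃ y ∈ H, y ≠ q ∧ y ≠ t ∧ y ≠ p ∧ M y q ≠ 0
  swap
  · push Not at hy'
    have hpq1 : M p q ≠ 0 := by
      obtain ⟨y, hyH, hyq, hyt, hyM⟩ := hy
      by_cases hyp : y = p
      · rwa [hyp] at hyM
      · exact absurd (hy' y hyH hyq hyt hyp) hyM
    have hpq2 := hbig' p hpH hpt
    obtain ⟨p', q', hpq', hrow⟩ := hM p hpH hpt
    have hq' : q' = q := by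
      by_contra hne
      rw [hrow, stdRow, if_neg (Ne.symm hne), add_zero] at hpq1 hpq2
      split_ifs at hpq1 hpq2 <;> simp_all
    subst hq'
    have h4 : pathCount M t (H.erase p) p' ≤ C := by
      refine (pathCount_le_erase_of_no_inEdge hqt hpq' fun z hz hzq hzt => ?_).trans (b2 p')
      rw [Finset.mem_erase] at hz
      exact hy' z hz.2 hzq hzt hz.1
    have h5 : pathCount M t H p ≤ m * C + C * a := by
      rw [pathCount_step hpH hpt, hrow, sum_stdRow_mul]
      nlinarith [b1 q']
    have h3 := mul_le_mul_of_nonneg_right (le_root_cube hm2 ha haa) hC0.le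
    have h6 := mul_le_mul_of_nonneg_left h5 (zero_le_one.trans hm')
    linarith
  obtain ⟨y, hyH, hyq, hyt, hyp, hyM⟩ := hy'
  set Z := ((H.erase p).erase t).filter fun z => M z p ≠ 0 with hZ
  have hZmem : ∀ v, v ∈ Z ↔ v ≠ t ∧ v ≠ p ∧ v ∈ H ∧ M v p ≠ 0 := fun v => by
    rw [hZ, Finset.mem_filter, Finset.mem_erase, Finset.mem_erase]; tauto
  -- For `m ≥ 2` a row has only one single edge; that of `y` goes to `q`, so none goes to `p`.
  have hyZ : y ∉ Z := fun h => by
    obtain ⟨-, -, -, h⟩ := (hZmem y).1 h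
    exact hpq ((hM y hyH hyt).eq_of_eq_one hm2 (hsmall y hyH hyt h) (hsmall' y hyH hyt hyM))
  have hzZ : z ∈ Z := (hZmem z).2 ⟨hzt, hzp, hzH, hzM⟩
  obtain ⟨r, hr⟩ := Nat.exists_eq_succ_of_ne_zero (Finset.card_ne_zero_of_mem hzZ)
  have hZsub : Z ⊆ (H.erase p).erase t := Finset.filter_subset _ _
  have hyB : y ∈ (H.erase p).erase t := by simp [hyt, hyp, hyH]
  set κ := ((m : ℝ) ^ 2 + 1) / a ^ 2 with hκ
  have hκ0 : 0 < κ := by positivity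
  have k1 : pathCount M t H p ≤ κ ^ (r + 1) * (a ^ 2 * C) := by
    have := (hPB H subset_rfl).le_of_subset hm ha (M := M) (s := p) (U := Z)
      (hZsub.trans (Finset.erase_subset_erase _ hHp)) (fun v hv hvt => (hM v hv hvt).le hm)
      (fun v hv hvt => (hM v hv hvt).sum_le _) (fun v hv => by
        obtain ⟨h1, h2, h3, h4⟩ := (hZmem v).1 hv
        exact (hM v h3 h1).sum_le_of_ne_zero h4 (by simp))
    rwa [cH, hr, pow_add a K, mul_comm (a ^ K)] at this
  have k2 : pathCount M t (H.erase p) q ≤ κ ^ (r + 1) * κ * (a * C) := by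
    have := (hPB _ hHp).le_of_subset hm ha (M := M) (s := q) (U := insert y Z)
      (Finset.insert_subset hyB hZsub)
      (fun v hv hvt => (hsub _ hHp v hv hvt).le hm)
      (fun v hv hvt => (hsub _ hHp v hv hvt).sum_le _) (fun v hv => by
        rcases Finset.mem_insert.1 hv with rfl | hv
        · exact (hM v hyH hyt).sum_le_of_ne_zero hyM (by simp)
        · obtain ⟨h1, h2, h3, h4⟩ := (hZmem v).1 hv
          exact (hM v h3 h1).sum_le_of_ne_zero h4 (by simp))
    rwa [cHp, Finset.card_insert_of_notMem hyZ, hr, pow_succ a K, mul_comm (a ^ K), pow_succ] at this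
  -- Contracting `z → p` gives `z` the full row of `p`, so `z` saves nothing; the rest of `Z` loses
  -- its edge to `p` and `y` its edge to the start `q`.
  have k3 : ∀ z ∈ Z, pathCount (Function.update M z (M p)) t (H.erase p) q ≤
      κ ^ (r + 1) * (a * C) := by
    intro z hz
    have hstd : ∀ v ∈ H.erase p, v ≠ t → IsStdRow m (Function.update M z (M p) v) := by
      intro v hv hvt
      by_cases hvz : v = z
      · subst hvz; rw [Function.update_self]; exact hM p hpH hpt
      · rw [Function.update_of_ne hvz]; exact hsub _ hHp v hv hvt
    have hyZ' : y ∉ Z.erase z := fun h => hyZ (Finset.mem_of_mem_erase h)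
    have := (hPB _ hHp).le_of_subset hm ha (M := Function.update M z (M p)) (s := q)
      (U := insert y (Z.erase z))
      (Finset.insert_subset hyB ((Finset.erase_subset _ _).trans hZsub))
      (fun v hv hvt => (hstd v hv hvt).le hm)
      (fun v hv hvt => (hstd v hv hvt).sum_le _) (fun v hv => by
        rcases Finset.mem_insert.1 hv with rfl | hv
        · rw [Function.update_of_ne (by rintro rfl; exact hyZ hz)]
          exact (hM v hyH hyt).sum_le_of_ne_zero hyM (by simp)
        · obtain ⟨h0, hv⟩ := Finset.mem_erase.1 hv
          obtain ⟨h1, h2, h3, h4⟩ := (hZmem v).1 hv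
          rw [Function.update_of_ne h0]
          exact (hM v h3 h1).sum_le_of_ne_zero h4 (by simp))
    rwa [cHp, Finset.card_insert_of_notMem hyZ', Finset.card_erase_add_one hz, hr, pow_succ a K,
      mul_comm (a ^ K)] at this
  have k4 : pathCount M t H q ≤ κ ^ (r + 1) * κ * (a * C) + (r + 1) * (κ ^ (r + 1) * (a * C)) := by
    refine (pathCount_le_erase_add_sum M hpt H (Ne.symm hpq)).trans (add_le_add k2 ?_)
    have h1 : ∑ z ∈ (H.erase p).erase t, (M z p : ℝ) *
        pathCount (Function.update M z (M p)) t (H.erase p) q =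
        ∑ z ∈ Z, (M z p : ℝ) * pathCount (Function.update M z (M p)) t (H.erase p) q := by
      rw [hZ, Finset.sum_filter_of_ne]
      intro z _ hne h0
      exact hne (by rw [h0, Nat.cast_zero, zero_mul])
    have h2 : (r + 1 : ℝ) = Z.card := by rw [hr]; push_cast; rfl
    rw [h1, h2, ← nsmul_eq_mul]
    refine Finset.sum_le_card_nsmul _ _ _ fun z hz => ?_
    obtain ⟨h1, h2, h3, h4⟩ := (hZmem z).1 hz
    rw [hsmall z h3 h1 h4, Nat.cast_one, one_mul]
    exact k3 z hz
  have k5 := weight_pow_mul_le hm ha haa r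
  rw [← hκ] at k5
  have k6 := mul_le_mul_of_nonneg_right k5 (mul_pos ha hC0).le
  calc m * pathCount M t H p + pathCount M t H q
      ≤ m * (κ ^ (r + 1) * (a ^ 2 * C)) +
        (κ ^ (r + 1) * κ * (a * C) + (r + 1) * (κ ^ (r + 1) * (a * C))) :=
        add_le_add (mul_le_mul_of_nonneg_left k1 (by linarith)) k4
    _ = κ ^ (r + 1) * (m * a + κ + (r + 1)) * (a * C) := by ring
    _ ≤ a ^ 2 * (a * C) := k6
    _ = a ^ 3 * C := by ring

end TwoSources

/-! ### The weighted path bound by induction on the vertex set. -/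

section Main

variable {V : Type*} [Fintype V] [DecidableEq V] {m : ℕ} {a : ℝ}

omit [Fintype V] in
theorem redirect_sum_le {M : V → V → ℕ} {A S : Finset V} {x : V} (hS : S ⊆ A) (hx : x ∈ S) (w : V) :
    ∑ u ∈ insert x (A \ S), redirect M S x w u ≤ ∑ u ∈ A, M w u := by
  rw [Finset.sum_insert (by simp [hx]), ← Finset.sum_sdiff hS, add_comm]
  refine add_le_add (Finset.sum_le_sum fun u hu => ?_) ?_
  · rw [redirect, if_neg]
    rintro ⟨-, rfl⟩
    simp [hx] at hu
  · rw [redirect]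
    split_ifs
    · exact le_rfl
    · exact Finset.single_le_sum (f := M w) (fun _ _ => Nat.zero_le _) hx

theorem exists_isStdRow_ge [Nontrivial V] {M : V → V → ℕ} (t : V) {A : Finset V} (s : V)
    (h : ∀ v ∈ A, v ≠ t → RowBound m A (M v) (m + 1)) :
    ∃ M' : V → V → ℕ, pathCount M t A s ≤ pathCount M' t A s ∧
      ∀ v ∈ A, v ≠ t → IsStdRow m (M' v) := by
  suffices H : ∀ W ⊆ A.erase t, ∃ M' : V → V → ℕ, pathCount M t A s ≤ pathCount M' t A s ∧
      (∀ v ∈ W, IsStdRow m (M' v)) ∧ ∀ v ∉ W, M' v = M v by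
    obtain ⟨M', h1, h2, -⟩ := H _ subset_rfl
    exact ⟨M', h1, fun v hv hvt => h2 v (Finset.mem_erase.2 ⟨hvt, hv⟩)⟩
  intro W
  induction W using Finset.induction_on with
  | empty => exact fun _ => ⟨M, le_rfl, by simp, fun _ _ => rfl⟩
  | insert z W hz ih =>
    intro hW
    obtain ⟨M', h1, h2, h3⟩ := ih ((Finset.subset_insert _ _).trans hW)
    have hzA := Finset.mem_erase.1 (hW (Finset.mem_insert_self _ _))
    have hr := h z hzA.2 hzA.1
    rw [← h3 z hz] at hr
    obtain ⟨p, q, hpq, h4⟩ := exists_stdRow_ge t s hr.sum_le hr.entry_le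
    refine ⟨_, h1.trans h4, fun v hv => ?_, fun v hv => ?_⟩
    · by_cases hvz : v = z
      · rw [hvz, Function.update_self]; exact ⟨p, q, hpq, rfl⟩
      · rw [Function.update_of_ne hvz]
        exact h2 v (Finset.mem_of_mem_insert_of_ne hv hvz)
    · rw [Finset.mem_insert, not_or] at hv
      rw [Function.update_of_ne hv.1, h3 v hv.2]

theorem pathBound (hm : 1 ≤ m) (ha : 0 < a) (haa : a ^ 2 = m * a + 1) (t : V) (A : Finset V) :
    PathBound m a t A := by
  induction A using Finset.strongInduction with
  | H A ih =>
  intro M₀ c s h₀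
  have hw : ∀ v ∈ A.erase t, 1 ≤ vertexWeight m a (c v) := fun v hv =>
    one_le_vertexWeight hm ha haa (h₀ v (Finset.mem_of_mem_erase hv) (Finset.ne_of_mem_erase hv)).one_le
  have hprod : 1 ≤ ∏ v ∈ A.erase t, vertexWeight m a (c v) := by
    simpa using Finset.prod_le_prod (fun _ _ => zero_le_one) hw
  by_cases hs : s ∈ A
  swap
  · rw [pathCount_of_notMem hs]; exact zero_le_one.trans hprod
  by_cases hst : s = t
  · subst hst; rwa [pathCount_target hs]
  -- Deleting the edges into `s` changes no path and makes the row bounds valid on all of `A`.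
  obtain ⟨M, hMM, hM⟩ : ∃ M : V → V → ℕ, pathCount M₀ t A s = pathCount M t A s ∧
      ∀ v ∈ A, v ≠ t → RowBound m A (M v) (c v) := by
    refine ⟨fun v u => if u = s then 0 else M₀ v u,
      pathCount_eq_of_forall_ne fun w _ u _ hu => by rw [if_neg hu], fun v hv hvt => ?_⟩
    obtain ⟨h1, h2, h3, h4⟩ := h₀ v hv hvt
    refine ⟨h1, h2, ?_, fun u hu => ?_⟩
    · rw [← Finset.add_sum_erase _ _ hs]
      simp only [if_true, zero_add]
      rwa [Finset.sum_congr rfl fun u hu => if_neg (Finset.ne_of_mem_erase hu)]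
    · dsimp only
      split_ifs with hus
      · exact Nat.zero_le _
      · exact h4 u (Finset.mem_erase.2 ⟨hus, hu⟩)
  rw [hMM]
  by_cases hc : ∃ z ∈ A, z ≠ t ∧ c z ≤ m
  · obtain ⟨z, hzA, hzt, hcz⟩ := hc
    rcases (A.erase z).eq_empty_or_nonempty with he | hne
    · have hsz : s = z := by
        by_contra hsz
        have : s ∈ A.erase z := Finset.mem_erase.2 ⟨hsz, hs⟩
        simp [he] at this
      rw [pathCount_step hs hst, hsz, he, Finset.sum_eq_zero]
      · exact zero_le_one.trans hprod
      · intro u _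
        rw [pathCount_of_notMem (by simp), mul_zero]
    obtain ⟨y, hyA, hyz, hle⟩ := exists_single_row_ge t s hne (hM z hzA hzt).sum_le
    refine hle.trans ?_
    set M₁ := Function.update M z (Pi.single y (c z)) with hM₁
    have hM₁z : M₁ z = Pi.single y (c z) := by rw [hM₁, Function.update_self]
    have hr : ∀ v ∈ A, v ≠ t → RowBound m A (M₁ v) (c v) := by
      intro v hv hvt
      by_cases hvz : v = z
      · subst hvz
        rw [hM₁z]
        refine ⟨(hM v hv hvt).one_le, (hM v hv hvt).le, ?_, fun u _ => ?_⟩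
        · rw [Finset.sum_pi_single', if_pos hyA]
        · rw [Pi.single_apply]; split_ifs <;> omega
      · rw [hM₁, Function.update_of_ne hvz]; exact hM v hv hvt
    obtain ⟨S, d, hS, hdK, hmax⟩ := exists_isAbsorbing hm ha haa hr hyA
    -- All edges of `z` go to `y ∈ S`, so maximality forces `z` into `S`; hence the contraction
    -- removes a vertex.
    have hzS : z ∈ S := by
      by_contra hzS
      obtain ⟨u, -, huS, hu⟩ := hmax z hzA hzS hzt
      rw [hM₁z, Pi.single_apply] at hu
      split_ifs at hu with huy
      · exact huS (huy ▸ hS.mem)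
      · exact hu rfl
    have hA' : insert y (A \ S) ⊂ A := by
      refine ⟨Finset.insert_subset hyA Finset.sdiff_subset, fun hh => ?_⟩
      have := hh hzA
      simp [hzS, Ne.symm hyz] at this
    have hrow : ∀ v ∈ insert y (A \ S), v ≠ t →
        RowBound m (insert y (A \ S)) (redirect M₁ S y v) (c v) := by
      intro v hv hvt
      have hvA := hA'.1 hv
      have hrv := hr v hvA hvt
      refine ⟨hrv.one_le, hrv.le, (redirect_sum_le hS.subset hS.mem v).trans hrv.sum_le, ?_⟩
      intro u hu
      rw [redirect]
      split_ifs with hc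
      -- The merged edge could have multiplicity `m + 1`, but by maximality `v` keeps an edge to a
      -- vertex outside `S`.
      · obtain ⟨w, hwA, hwS, hw⟩ := hmax v hvA hc.1 hvt
        have h1 := hrv.sum_le
        have h2 := hrv.le
        rw [← Finset.sum_sdiff hS.subset] at h1
        have h3 := Finset.single_le_sum (f := M₁ v) (fun _ _ => Nat.zero_le _)
          (Finset.mem_sdiff.2 ⟨hwA, hwS⟩)
        omega
      · exact hrv.entry_le u (hA'.1 hu)
    have key : ∀ s', pathCount (redirect M₁ S y) t (insert y (A \ S)) s' ≤
        ∏ v ∈ (insert y (A \ S)).erase t, vertexWeight m a (c v) := fun s' =>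
      ih _ hA' _ c s' fun v hv hvt => (hrow v hv hvt).mono (Finset.erase_subset _ _)
    have hunion : A.erase t = S.erase y ∪ (insert y (A \ S)).erase t := by
      ext v
      simp only [Finset.mem_erase, Finset.mem_union, Finset.mem_insert, Finset.mem_sdiff]
      constructor
      · rintro ⟨h1, h2⟩
        by_cases h3 : v = y
        · exact Or.inr ⟨h1, Or.inl h3⟩
        · by_cases h4 : v ∈ S
          · exact Or.inl ⟨h3, h4⟩
          · exact Or.inr ⟨h1, Or.inr ⟨h2, h4⟩⟩
      · rintro (⟨h1, h2⟩ | ⟨h1, rfl | h2⟩)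
        · exact ⟨by rintro rfl; exact h1 (hS.target h2), hS.subset h2⟩
        · exact ⟨h1, hyA⟩
        · exact ⟨h1, h2.1⟩
    have hdisj : Disjoint (S.erase y) ((insert y (A \ S)).erase t) := by
      rw [Finset.disjoint_left]
      intro v h1 h2
      simp only [Finset.mem_erase, Finset.mem_insert, Finset.mem_sdiff] at h1 h2
      tauto
    have hK0 : 0 ≤ ∏ v ∈ S.erase y, vertexWeight m a (c v) :=
      Finset.prod_nonneg fun v hv => zero_le_one.trans
        (hw v (hunion ▸ Finset.mem_union_left _ hv))
    rw [hunion, Finset.prod_union hdisj]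
    by_cases hsS : s ∈ S
    · exact (hS.pathCount_le_mul subset_rfl hyA hsS).trans
        (mul_le_mul (hdK s hsS) (key y) (pathCount_nonneg _ _ _ _) hK0)
    · exact (hS.pathCount_le_mul_of_notMem hdK subset_rfl hyA hsS).trans
        (mul_le_mul_of_nonneg_left (key s) hK0)
  · push Not at hc
    have hc' : ∀ v ∈ A, v ≠ t → c v = m + 1 := fun v hv hvt => by
      have h1 := hc v hv hvt
      have h2 := (hM v hv hvt).le
      omega
    have : Nontrivial V := ⟨s, t, hst⟩
    obtain ⟨M', hle, hstd⟩ := exists_isStdRow_ge t s fun v hv hvt => by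
      rw [← hc' v hv hvt]; exact hM v hv hvt
    refine hle.trans ?_
    obtain ⟨p, q, hpq, hrow⟩ := hstd s hs hst
    rw [pathCount_step hs hst, hrow, sum_stdRow_mul]
    refine (two_sources_le hm ha haa (fun B hB => ih B (lt_of_le_of_lt hB (Finset.erase_ssubset hs)))
      (fun v hv hvt => hstd v (Finset.mem_of_mem_erase hv) hvt) hpq).trans (le_of_eq ?_)
    rw [Finset.erase_right_comm, Finset.card_erase_add_one (Finset.mem_erase.2 ⟨hst, hs⟩),
      ← Finset.prod_const]
    refine Finset.prod_congr rfl fun v hv => ?_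
    rw [Finset.mem_erase] at hv
    rw [hc' v hv.2 hv.1, vertexWeight, if_neg (by omega)]

theorem pathCount_le_root_pow (hm : 1 ≤ m) (ha : 0 < a) (haa : a ^ 2 = m * a + 1) {M : V → V → ℕ}
    (hsum : ∀ v, ∑ u, M v u ≤ m + 1) (hent : ∀ v u, M v u ≤ m) (s t : V) :
    pathCount M t Finset.univ s ≤ a ^ (Fintype.card V - 1) := by
  have := (pathBound hm ha haa t Finset.univ).le_of_subset hm ha (M := M) (s := s) (U := ∅)
    (by simp) (fun v _ _ => hent v) (fun v _ _ =>
      (Finset.sum_le_sum_of_subset (Finset.erase_subset _ _)).trans (hsum v)) (by simp)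
  simpa using this

end Main

/-! ### From path-cycles to paths. -/

section Trails

instance {V : Type*} [DecidableEq V] (G : MultiDigraph V) : DecidableEq G.Edge := by
  unfold Edge; infer_instance

/-- The edge lists of paths from `v` inside `A`, each followed by one more edge. -/
def trails {V : Type*} [Fintype V] [DecidableEq V] (G : MultiDigraph V) :
    ℕ → Finset V → V → Finset (List G.Edge)
  | 0, _, _ => ∅
  | n + 1, A, v =>
    if v ∈ A then
      Finset.univ.biUnion fun u => Finset.univ.biUnion fun i : Fin (G.mult v u) =>
        insert [⟨(v, u), i⟩] ((trails G n (A.erase v) u).image (List.cons ⟨(v, u), i⟩))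
    else ∅

variable {V : Type*} [Fintype V] [DecidableEq V] {G : MultiDigraph V} {n : ℕ} {A : Finset V}

theorem singleton_mem_trails {e : G.Edge} (h : e.src ∈ A) : [e] ∈ trails G (n + 1) A e.src := by
  obtain ⟨⟨v, u⟩, i⟩ := e
  rw [trails, if_pos h]
  simp only [Finset.mem_biUnion, Finset.mem_univ, true_and]
  exact ⟨u, i, Finset.mem_insert_self _ _⟩

theorem cons_mem_trails {e : G.Edge} {l : List G.Edge} (h : e.src ∈ A)
    (hl : l ∈ trails G n (A.erase e.src) e.tgt) : e :: l ∈ trails G (n + 1) A e.src := by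
  obtain ⟨⟨v, u⟩, i⟩ := e
  rw [trails, if_pos h]
  simp only [Finset.mem_biUnion, Finset.mem_univ, true_and]
  refine ⟨u, i, Finset.mem_insert_of_mem (Finset.mem_image_of_mem _ ?_)⟩
  exact hl

/-- A trail is a path to some `t` followed by one of the at most `k` edges out of `t`; where that
edge ends is ignored. -/
theorem card_trails_le {k : ℕ} (hG : ∀ v, G.outdegree v ≤ k) (n : ℕ) (A : Finset V) (v : V) :
    ((trails G n A v).card : ℝ) ≤ k * ∑ t ∈ A, pathCount G.mult t A v := by
  have nn : ∀ (A : Finset V) (v : V), 0 ≤ ∑ t ∈ A, pathCount G.mult t A v := fun A v =>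
    Finset.sum_nonneg fun t _ => pathCount_nonneg _ _ _ _
  induction n generalizing A v with
  | zero =>
    rw [trails, Finset.card_empty, Nat.cast_zero]
    exact mul_nonneg (Nat.cast_nonneg _) (nn A v)
  | succ n ih =>
    by_cases hv : v ∈ A
    swap
    · rw [trails, if_neg hv, Finset.card_empty, Nat.cast_zero]
      exact mul_nonneg (Nat.cast_nonneg _) (nn A v)
    have h1 : ∑ t ∈ A, pathCount G.mult t A v =
        1 + ∑ u, (G.mult v u : ℝ) * ∑ t ∈ A.erase v, pathCount G.mult t (A.erase v) u := by
      rw [← Finset.add_sum_erase _ _ hv, pathCount_target hv]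
      simp_rw [Finset.mul_sum]
      rw [Finset.sum_comm, add_right_inj]
      exact Finset.sum_congr rfl fun t ht =>
        pathCount_step hv (Ne.symm (Finset.ne_of_mem_erase ht))
    have h2 : (trails G (n + 1) A v).card ≤
        ∑ u, G.mult v u * ((trails G n (A.erase v) u).card + 1) := by
      rw [trails, if_pos hv]
      refine Finset.card_biUnion_le.trans (Finset.sum_le_sum fun u _ => ?_)
      refine Finset.card_biUnion_le.trans ?_
      refine (Finset.sum_le_card_nsmul _ _ ((trails G n (A.erase v) u).card + 1)
        fun i _ => ?_).trans (by simp)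
      refine (Finset.card_insert_le _ _).trans (Nat.add_le_add_right ?_ 1)
      convert Finset.card_image_le
    have h3 : (∑ u, (G.mult v u : ℝ)) ≤ k := by exact_mod_cast hG v
    calc ((trails G (n + 1) A v).card : ℝ)
        ≤ ∑ u, (G.mult v u : ℝ) * ((trails G n (A.erase v) u).card + 1) := by exact_mod_cast h2
      _ ≤ ∑ u, (G.mult v u : ℝ) *
          (k * (∑ t ∈ A.erase v, pathCount G.mult t (A.erase v) u) + 1) :=
          Finset.sum_le_sum fun u _ => mul_le_mul_of_nonneg_left
            (add_le_add_left (ih _ u) 1) (Nat.cast_nonneg _)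
      _ = k * (∑ u, (G.mult v u : ℝ) * ∑ t ∈ A.erase v, pathCount G.mult t (A.erase v) u) +
          ∑ u, (G.mult v u : ℝ) := by
          rw [Finset.mul_sum, ← Finset.sum_add_distrib]
          exact Finset.sum_congr rfl fun u _ => by ring
      _ ≤ k * ∑ t ∈ A, pathCount G.mult t A v := by rw [h1]; linarith

theorem ofFn_mem_trails {r : ℕ} {v : Fin (r + 1) → V} {e : Fin (r + 1) → G.Edge}
    (hv : Function.Injective v) (hA : ∀ i, v i ∈ A) (hsrc : ∀ i, (e i).src = v i)
    (htgt : ∀ i : Fin r, (e i.castSucc).tgt = v i.succ) (hn : r + 1 ≤ n) :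
    List.ofFn e ∈ trails G n A (v 0) := by
  induction r generalizing n A with
  | zero =>
    obtain ⟨n, rfl⟩ := Nat.exists_eq_succ_of_ne_zero (by omega : n ≠ 0)
    have h := singleton_mem_trails (n := n) (A := A) (e := e 0) (by rw [hsrc]; exact hA 0)
    rw [hsrc] at h
    simpa using h
  | succ r ih =>
    obtain ⟨n, rfl⟩ := Nat.exists_eq_succ_of_ne_zero (by omega : n ≠ 0)
    have h1 := ih (n := n) (A := A.erase (v 0)) (v := fun i => v i.succ) (e := fun i => e i.succ)
      (hv.comp (Fin.succ_injective _))
      (fun i => Finset.mem_erase.2 ⟨fun h => Fin.succ_ne_zero i (hv h), hA _⟩)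
      (fun i => hsrc _) (fun i => htgt i.succ) (by omega)
    have h2 := cons_mem_trails (n := n) (A := A) (e := e 0) (l := List.ofFn fun i => e i.succ)
      (by rw [hsrc]; exact hA 0) (by
        have h3 : (e 0).tgt = v 1 := htgt 0
        rw [hsrc, h3]; exact h1)
    rw [hsrc] at h2
    rwa [List.ofFn_succ]

/-- The edge list of a path-cycle is a trail and determines it: every vertex is the source of one of
its edges. -/
theorem numPathCycles_le {k : ℕ} (hG : ∀ v, G.outdegree v ≤ k) :
    (G.numPathCycles : ℝ) ≤ k * ∑ s, ∑ t, pathCount G.mult t Finset.univ s := by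
  choose r m v e hm h using fun H : {H : G.Subgraph // H.IsPathCycle} => H.2
  have hmem : ∀ H, List.ofFn (e H) ∈
      Finset.univ.biUnion fun s => trails G (Fintype.card V) Finset.univ s := by
    intro H
    obtain ⟨h1, h2, h3, h4, h5, h6⟩ := h H
    have hle := Fintype.card_le_of_injective _ h1
    rw [Fintype.card_fin] at hle
    exact Finset.mem_biUnion.2 ⟨v H 0, Finset.mem_univ _,
      ofFn_mem_trails h1 (fun _ => Finset.mem_univ _) h4 h5 hle⟩
  have hinj : Function.Injective fun H => List.ofFn (e H) := by
    intro H H' hHH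
    obtain ⟨-, h2, h3, h4, -⟩ := h H
    obtain ⟨-, h2', h3', h4', -⟩ := h H'
    have hrange : Set.range (e H) = Set.range (e H') := by
      ext x
      rw [← List.mem_ofFn', ← List.mem_ofFn']
      exact iff_of_eq (congrArg (x ∈ ·) hHH)
    have hv : Set.range (v H) = Set.range (v H') := by
      have e1 : v H = Edge.src ∘ e H := funext fun i => (h4 i).symm
      have e2 : v H' = Edge.src ∘ e H' := funext fun i => (h4' i).symm
      rw [e1, e2, Set.range_comp, Set.range_comp, hrange]
    exact Subtype.ext (Subgraph.ext (by rw [h2, h2', hv]) (by rw [h3, h3', hrange]))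
  have h1 : G.numPathCycles ≤
      (Finset.univ.biUnion fun s => trails G (Fintype.card V) Finset.univ s).card := by
    rw [numPathCycles, ← Nat.card_eq_finsetCard]
    exact Nat.card_le_card_of_injective (fun H => ⟨List.ofFn (e H), hmem H⟩) fun H H' hHH =>
      hinj (congrArg Subtype.val hHH)
  calc (G.numPathCycles : ℝ)
      ≤ ∑ s, ((trails G (Fintype.card V) Finset.univ s).card : ℝ) := by
        exact_mod_cast h1.trans Finset.card_biUnion_le
    _ ≤ ∑ s, k * ∑ t, pathCount G.mult t Finset.univ s :=
        Finset.sum_le_sum fun s _ => card_trails_le hG _ _ _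
    _ = k * ∑ s, ∑ t, pathCount G.mult t Finset.univ s := by rw [Finset.mul_sum]

end Trails

/-! ### Bregman's theorem and paths in simple digraphs. -/

section Bregman

/-- The logarithm of `(r !) ^ (1 / r)`. -/
noncomputable def logFactorialMean (r : ℕ) : ℝ := Real.log (r.factorial : ℝ) / r

theorem logFactorialMean_nonneg (r : ℕ) : 0 ≤ logFactorialMean r :=
  div_nonneg (Real.log_nonneg (by exact_mod_cast Nat.factorial_pos r)) (Nat.cast_nonneg _)

theorem mul_logFactorialMean (r : ℕ) : r * logFactorialMean r = Real.log (r.factorial : ℝ) := by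
  rw [logFactorialMean]
  rcases Nat.eq_zero_or_pos r with rfl | hr
  · simp
  · rw [mul_div_cancel₀]
    exact_mod_cast hr.ne'

theorem logFactorialMean_mono : Monotone logFactorialMean := by
  refine monotone_nat_of_le_succ fun r => ?_
  rcases Nat.eq_zero_or_pos r with rfl | hr
  · simp [logFactorialMean]
  have hr' : (0 : ℝ) < r := by exact_mod_cast hr
  have h1 : Real.log (r.factorial : ℝ) ≤ r * Real.log ((r : ℝ) + 1) := by
    rw [← Real.log_pow]
    refine Real.log_le_log (by exact_mod_cast Nat.factorial_pos r) ?_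
    exact_mod_cast (Nat.factorial_le_pow r).trans (Nat.pow_le_pow_left (Nat.le_succ r) r)
  have h2 : Real.log ((r + 1).factorial : ℝ) =
      Real.log ((r : ℝ) + 1) + Real.log (r.factorial : ℝ) := by
    rw [Nat.factorial_succ, Nat.cast_mul, Nat.cast_succ, Real.log_mul (by positivity)
      (by exact_mod_cast (Nat.factorial_pos r).ne')]
  rw [logFactorialMean, logFactorialMean, h2, Nat.cast_succ, div_le_div_iff₀ hr' (by positivity)]
  linarith

/-- The tangent line bound `log y ≤ y - 1` at `y = c / x`; for `x = 0` the convention `log 0 = 0`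
fits. -/
theorem sub_le_mul_log_sub {x c : ℝ} (hx : 0 ≤ x) (hc : 0 < c) :
    x - c ≤ x * Real.log x - x * Real.log c := by
  rcases hx.eq_or_lt with rfl | hx
  · simpa using hc.le
  · have h1 := Real.log_le_sub_one_of_pos (div_pos hc hx)
    rw [Real.log_div hc.ne' hx.ne'] at h1
    have h2 := mul_le_mul_of_nonneg_left h1 hx.le
    have h3 : x * (c / x - 1) = c - x := by field_simp
    linarith

/-- Convexity of `x log x`. -/
theorem sum_mul_log_sum_le {ι : Type*} {W : Finset ι} {x : ι → ℝ} (hx : ∀ k, 0 ≤ x k)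
    (hpos : 0 < ∑ k ∈ W, x k) :
    (∑ k ∈ W, x k) * Real.log (∑ k ∈ W, x k) ≤
      (∑ k ∈ W, x k) * Real.log W.card + ∑ k ∈ W, x k * Real.log (x k) := by
  set P := ∑ k ∈ W, x k with hP
  have hW : (0 : ℝ) < W.card := by
    rcases W.eq_empty_or_nonempty with rfl | h
    · simp [hP] at hpos
    · exact_mod_cast h.card_pos
  have h1 : ∑ k ∈ W, (x k - P / W.card) ≤
      ∑ k ∈ W, (x k * Real.log (x k) - x k * Real.log (P / W.card)) :=
    Finset.sum_le_sum fun k _ => sub_le_mul_log_sub (hx k) (div_pos hpos hW)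
  rw [Finset.sum_sub_distrib, Finset.sum_sub_distrib, Finset.sum_const, nsmul_eq_mul,
    mul_div_cancel₀ _ hW.ne', ← Finset.sum_mul, ← hP, Real.log_div hpos.ne' hW.ne'] at h1
  linarith

variable {V : Type*} [Fintype V] [DecidableEq V]

open Classical in
/-- The injections from `I` to `J` that map each `v` into `R v`, extended by the identity. -/
noncomputable def matchings (R : V → Finset V) (I J : Finset V) : Finset (V → V) :=
  Finset.univ.filter fun f =>
    (∀ v ∈ I, f v ∈ J ∧ f v ∈ R v) ∧ Set.InjOn f I ∧ ∀ v ∉ I, f v = v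

theorem mem_matchings {R : V → Finset V} {I J : Finset V} {f : V → V} :
    f ∈ matchings R I J ↔
      (∀ v ∈ I, f v ∈ J ∧ f v ∈ R v) ∧ Set.InjOn f I ∧ ∀ v ∉ I, f v = v := by
  simp [matchings]

theorem card_fiber_matchings_le (R : V → Finset V) (I J : Finset V) {i : V} (hi : i ∈ I) (k : V) :
    ((matchings R I J).filter fun f => f i = k).card ≤
      (matchings R (I.erase i) (J.erase k)).card := by
  refine Finset.card_le_card_of_injOn (fun f => Function.update f i i) ?_ ?_
  · intro f hf
    obtain ⟨hf, hfi⟩ := Finset.mem_filter.1 hf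
    obtain ⟨h1, h2, h3⟩ := mem_matchings.1 hf
    refine mem_matchings.2 ⟨fun v hv => ?_, ?_, ?_⟩
    · dsimp only
      obtain ⟨hvi, hv⟩ := Finset.mem_erase.1 hv
      rw [Function.update_of_ne hvi]
      exact ⟨Finset.mem_erase.2 ⟨fun h => hvi (h2 hv hi (h.trans hfi.symm)), (h1 v hv).1⟩,
        (h1 v hv).2⟩
    · intro v hv w hw hvw
      obtain ⟨hvi, hv⟩ := Finset.mem_erase.1 hv
      obtain ⟨hwi, hw⟩ := Finset.mem_erase.1 hw
      simp only [Function.update_of_ne hvi, Function.update_of_ne hwi] at hvw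
      exact h2 hv hw hvw
    · intro v hv
      dsimp only
      by_cases hvi : v = i
      · rw [hvi, Function.update_self]
      · rw [Function.update_of_ne hvi]
        exact h3 v fun h => hv (Finset.mem_erase.2 ⟨hvi, h⟩)
  · intro f hf g hg hfg
    have hfi := (Finset.mem_filter.1 hf).2
    have hgi := (Finset.mem_filter.1 hg).2
    funext v
    by_cases hvi : v = i
    · rw [hvi, hfi, hgi]
    · simpa [Function.update_of_ne hvi] using congrFun hfg v

/-- As `i` varies, `f i` runs through `J` without `f j`. With `w = (R j ∩ J).card`, the `w - 1`
deletions inside `R j` contribute `log (w - 1)!` in total, which `log w` completes to `log w!`, that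
is, `w` copies of the mean; each other deletion contributes one copy. -/
theorem sum_log_erase_eq {R : V → Finset V} {I J : Finset V} (hIJ : I.card = J.card) {f : V → V}
    (hf : f ∈ matchings R I J) {j : V} (hj : j ∈ I) :
    ∑ i ∈ I.erase j, logFactorialMean (R j ∩ J.erase (f i)).card +
      Real.log (R j ∩ J).card = I.card * logFactorialMean (R j ∩ J).card := by
  obtain ⟨h1, h2, -⟩ := mem_matchings.1 hf
  have himg : I.image f = J := Finset.eq_of_subset_of_card_le
    (Finset.image_subset_iff.2 fun v hv => (h1 v hv).1)
    (by rw [Finset.card_image_of_injOn h2, hIJ])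
  have himg' : (I.erase j).image f = J.erase (f j) := by
    ext k
    rw [← himg]
    simp only [Finset.mem_image, Finset.mem_erase]
    constructor
    · rintro ⟨v, ⟨hvj, hv⟩, rfl⟩
      exact ⟨fun h => hvj (h2 hv hj h), v, hv, rfl⟩
    · rintro ⟨hk, v, hv, rfl⟩
      exact ⟨v, ⟨fun h => hk (h ▸ rfl), hv⟩, rfl⟩
  have hinj : Set.InjOn f (I.erase j) := h2.mono (by simp)
  have hfj : f j ∈ R j ∩ J := Finset.mem_inter.2 ⟨(h1 j hj).2, (h1 j hj).1⟩
  have hstep : ∑ i ∈ I.erase j, logFactorialMean (R j ∩ J.erase (f i)).card =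
      ∑ k ∈ J.erase (f j), logFactorialMean ((R j ∩ J).erase k).card := by
    rw [← himg', Finset.sum_image hinj]
    exact Finset.sum_congr rfl fun i _ => by rw [Finset.inter_erase]
  set W := R j ∩ J with hW
  have hWJ : W ⊆ J := Finset.inter_subset_right
  obtain ⟨r, hr⟩ := Nat.exists_eq_succ_of_ne_zero (Finset.card_ne_zero_of_mem hfj)
  have hle := Finset.card_le_card hWJ
  have hsplit : J.erase (f j) = W.erase (f j) ∪ J \ W := by
    ext k
    simp only [Finset.mem_erase, Finset.mem_union, Finset.mem_sdiff]
    constructor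
    · rintro ⟨a, b⟩
      by_cases hk : k ∈ W
      · exact Or.inl ⟨a, hk⟩
      · exact Or.inr ⟨b, hk⟩
    · rintro (⟨a, b⟩ | ⟨a, b⟩)
      · exact ⟨a, hWJ b⟩
      · exact ⟨fun h => b (h ▸ hfj), a⟩
  have hdisj : Disjoint (W.erase (f j)) (J \ W) :=
    Finset.disjoint_sdiff.mono_left (Finset.erase_subset _ _)
  rw [hstep, hsplit, Finset.sum_union hdisj,
    Finset.sum_congr rfl (g := fun _ => logFactorialMean r) fun k hk => by
      rw [Finset.card_erase_of_mem (Finset.mem_of_mem_erase hk), hr, Nat.succ_sub_one],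
    Finset.sum_congr (s₁ := J \ W) rfl (g := fun _ => logFactorialMean W.card) fun k hk => by
      rw [Finset.erase_eq_of_notMem (Finset.mem_sdiff.1 hk).2],
    Finset.sum_const, Finset.sum_const, Finset.card_erase_of_mem hfj, nsmul_eq_mul, nsmul_eq_mul,
    Finset.card_sdiff_of_subset hWJ, Nat.cast_sub hle, hIJ, hr, Nat.succ_sub_one,
    mul_logFactorialMean]
  have h5 : Real.log (r.factorial : ℝ) + Real.log ((r.succ : ℕ) : ℝ) =
      (r.succ : ℕ) * logFactorialMean r.succ := by
    rw [mul_logFactorialMean, Nat.factorial_succ, Nat.cast_mul, Real.log_mul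
      (by exact_mod_cast Nat.succ_ne_zero r) (by exact_mod_cast (Nat.factorial_pos r).ne'),
      add_comm]
  linarith

/-- Bregman's theorem on permanents. -/
theorem log_card_matchings_le (R : V → Finset V) (I J : Finset V) (hIJ : I.card = J.card) :
    Real.log ((matchings R I J).card : ℝ) ≤ ∑ v ∈ I, logFactorialMean (R v ∩ J).card := by
  induction I using Finset.strongInduction generalizing J with
  | H I ih =>
  set S := matchings R I J with hS
  have hnonneg : 0 ≤ ∑ v ∈ I, logFactorialMean (R v ∩ J).card :=
    Finset.sum_nonneg fun v _ => logFactorialMean_nonneg _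
  rcases Nat.eq_zero_or_pos S.card with h0 | hpos
  · rw [h0]; simpa using hnonneg
  rcases I.eq_empty_or_nonempty with rfl | hne
  · have : S.card ≤ 1 := Finset.card_le_one.2 fun f hf g hg => by
      funext v
      rw [(mem_matchings.1 hf).2.2 v (by simp), (mem_matchings.1 hg).2.2 v (by simp)]
    have h1 : S.card = 1 := by omega
    rw [h1]; simp
  have hP : (0 : ℝ) < S.card := by exact_mod_cast hpos
  have hn : (0 : ℝ) < I.card := by exact_mod_cast hne.card_pos
  -- Schrijver's argument: split the matchings by the value at `i`, apply convexity of `x log x` and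
  -- induction to the fibres, then sum over all `i`, so that `sum_log_erase_eq` applies to each
  -- matching.
  have step : ∀ i ∈ I, (S.card : ℝ) * Real.log S.card ≤ S.card * Real.log (R i ∩ J).card +
      ∑ f ∈ S, ∑ j ∈ I.erase i, logFactorialMean (R j ∩ J.erase (f i)).card := by
    intro i hi
    have hmaps : ∀ f ∈ S, f i ∈ R i ∩ J := fun f hf => by
      have := (mem_matchings.1 hf).1 i hi
      exact Finset.mem_inter.2 ⟨this.2, this.1⟩
    have hcard : (S.card : ℝ) = ∑ k ∈ R i ∩ J, ((S.filter fun f => f i = k).card : ℝ) := by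
      exact_mod_cast Finset.card_eq_sum_card_fiberwise (f := fun f : V → V => f i) hmaps
    have h1 := sum_mul_log_sum_le (W := R i ∩ J)
      (x := fun k => ((S.filter fun f => f i = k).card : ℝ)) (fun k => Nat.cast_nonneg _)
      (hcard ▸ hP)
    rw [← hcard] at h1
    refine h1.trans (add_le_add_right ?_ _)
    rw [← Finset.sum_fiberwise_of_maps_to hmaps]
    refine Finset.sum_le_sum fun k hk => ?_
    have h2 : ∑ f ∈ S with f i = k, ∑ j ∈ I.erase i, logFactorialMean (R j ∩ J.erase (f i)).card =
        ((S.filter fun f => f i = k).card : ℝ) *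
          ∑ j ∈ I.erase i, logFactorialMean (R j ∩ J.erase k).card := by
      rw [← nsmul_eq_mul, ← Finset.sum_const]
      exact Finset.sum_congr rfl fun f hf => by rw [(Finset.mem_filter.1 hf).2]
    rw [h2]
    refine mul_le_mul_of_nonneg_left ?_ (Nat.cast_nonneg _)
    rcases Nat.eq_zero_or_pos (S.filter fun f => f i = k).card with h0 | h0
    · rw [h0]
      simpa using Finset.sum_nonneg fun j _ => logFactorialMean_nonneg _
    · have hk' := (Finset.mem_inter.1 hk).2
      refine le_trans ?_ (ih (I.erase i) (Finset.erase_ssubset hi) (J.erase k) (by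
        rw [Finset.card_erase_of_mem hi, Finset.card_erase_of_mem hk', hIJ]))
      exact Real.log_le_log (by exact_mod_cast h0)
        (by exact_mod_cast card_fiber_matchings_le R I J hi k)
  have htot := Finset.sum_le_sum step
  rw [Finset.sum_const, nsmul_eq_mul, Finset.sum_add_distrib, ← Finset.mul_sum,
    Finset.sum_comm] at htot
  have h3 : ∀ f ∈ S, ∑ i ∈ I, ∑ j ∈ I.erase i, logFactorialMean (R j ∩ J.erase (f i)).card =
      ∑ j ∈ I, (I.card * logFactorialMean (R j ∩ J).card - Real.log (R j ∩ J).card) := by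
    intro f hf
    rw [Finset.sum_comm' (t' := I) (s' := fun j => I.erase j)]
    · exact Finset.sum_congr rfl fun j hj => by
        rw [← sum_log_erase_eq hIJ hf hj, add_sub_cancel_right]
    · intro i j
      simp only [Finset.mem_erase]
      tauto
  rw [Finset.sum_congr rfl h3, Finset.sum_const, nsmul_eq_mul, Finset.sum_sub_distrib,
    ← Finset.mul_sum] at htot
  have h4 : (I.card : ℝ) * S.card * Real.log S.card ≤
      I.card * S.card * ∑ v ∈ I, logFactorialMean (R v ∩ J).card := by linarith
  exact le_of_mul_le_mul_left h4 (mul_pos hn hP)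

/-- A path sends each of its vertices except `t` to its successor, and the vertices off the path are
fixed; this is why `v` is added to its own row. Since edges are simple, the path can be recovered.
-/
theorem pathCount_le_card_matchings {M : V → V → ℕ} (hM : ∀ v u, M v u ≤ 1) (t : V) (A : Finset V)
    (s : V) : pathCount M t A s ≤ ((matchings (fun v =>
      insert v (Finset.univ.filter fun u => M v u ≠ 0)) (A.erase t) (A.erase s)).card : ℝ) := by
  set R : V → Finset V := fun v => insert v (Finset.univ.filter fun u => M v u ≠ 0) with hR
  induction A using Finset.strongInduction generalizing s with
  | H A ih =>
  by_cases hs : s ∈ A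
  swap
  · rw [pathCount_of_notMem hs]; exact Nat.cast_nonneg _
  by_cases hst : s = t
  · subst hst
    rw [pathCount_target hs]
    have : id ∈ matchings R (A.erase s) (A.erase s) :=
      mem_matchings.2 ⟨fun v hv => ⟨hv, by simp [hR]⟩, Function.injective_id.injOn, fun _ _ => rfl⟩
    exact_mod_cast Finset.card_pos.2 ⟨_, this⟩
  have hsI : s ∈ A.erase t := Finset.mem_erase.2 ⟨hst, hs⟩
  rw [pathCount_step hs hst, Finset.card_eq_sum_card_fiberwise (f := fun f : V → V => f s)
    (t := Finset.univ) (fun _ _ => Finset.mem_coe.2 (Finset.mem_univ _)), Nat.cast_sum]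
  refine Finset.sum_le_sum fun u _ => ?_
  by_cases hu : u ∈ A.erase s
  swap
  · rw [pathCount_of_notMem hu, mul_zero]; exact Nat.cast_nonneg _
  by_cases hMu : M s u = 0
  · rw [hMu, Nat.cast_zero, zero_mul]; exact Nat.cast_nonneg _
  have hM1 : M s u = 1 := by have := hM s u; omega
  rw [hM1, Nat.cast_one, one_mul]
  refine (ih _ (Finset.erase_ssubset hs) u).trans ?_
  rw [Nat.cast_le, Finset.erase_right_comm]
  refine Finset.card_le_card_of_injOn (fun f => Function.update f s u) ?_ ?_
  · intro f hf
    obtain ⟨h1, h2, h3⟩ := mem_matchings.1 hf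
    refine Finset.mem_coe.2 (Finset.mem_filter.2 ⟨mem_matchings.2 ⟨fun v hv => ?_, ?_, ?_⟩,
      Function.update_self _ _ _⟩)
    · dsimp only
      by_cases hvs : v = s
      · rw [hvs, Function.update_self]
        exact ⟨hu, by simp [hR, hM1]⟩
      · rw [Function.update_of_ne hvs]
        obtain ⟨h4, h5⟩ := h1 v (Finset.mem_erase.2 ⟨hvs, hv⟩)
        exact ⟨Finset.mem_of_mem_erase h4, h5⟩
    -- The value `u` is free for `s`, since the matching for the remaining path omits its start `u`
    -- from the codomain.
    · have hne : ∀ w ∈ A.erase t, w ≠ s → f w ≠ u := fun w hw hws =>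
        Finset.ne_of_mem_erase (h1 w (Finset.mem_erase.2 ⟨hws, hw⟩)).1
      intro v hv w hw hvw
      dsimp only at hvw
      by_cases hvs : v = s <;> by_cases hws : w = s
      · rw [hvs, hws]
      · rw [hvs, Function.update_self, Function.update_of_ne hws] at hvw
        exact absurd hvw.symm (hne w hw hws)
      · rw [hws, Function.update_self, Function.update_of_ne hvs] at hvw
        exact absurd hvw (hne v hv hvs)
      · rw [Function.update_of_ne hvs, Function.update_of_ne hws] at hvw
        exact h2 (by simpa [hvs] using hv) (by simpa [hws] using hw) hvw
    · intro v hv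
      have hvs : v ≠ s := by rintro rfl; exact hv hsI
      dsimp only
      rw [Function.update_of_ne hvs]
      exact h3 v fun h => hv (Finset.mem_of_mem_erase h)
  · intro f hf g hg hfg
    obtain ⟨-, -, hf⟩ := mem_matchings.1 hf
    obtain ⟨-, -, hg⟩ := mem_matchings.1 hg
    funext v
    by_cases hvs : v = s
    · rw [hf v (by simp [hvs]), hg v (by simp [hvs])]
    · simpa [Function.update_of_ne hvs] using congrFun hfg v

theorem pathCount_le_factorial_rpow {M : V → V → ℕ} {k : ℕ} (hM : ∀ v u, M v u ≤ 1)
    (hk : ∀ v, ∑ u, M v u ≤ k) (s t : V) :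
    pathCount M t Finset.univ s ≤
      ((k + 1).factorial : ℝ) ^ (((Fintype.card V : ℝ) - 1) / ((k : ℝ) + 1)) := by
  set R : V → Finset V := fun v => insert v (Finset.univ.filter fun u => M v u ≠ 0) with hR
  have hRk : ∀ v, (R v).card ≤ k + 1 := fun v => by
    refine (Finset.card_insert_le _ _).trans (Nat.add_le_add_right (le_trans ?_ (hk v)) 1)
    rw [Finset.card_filter]
    exact Finset.sum_le_sum fun u _ => by split_ifs <;> omega
  have h1 := pathCount_le_card_matchings hM t Finset.univ s
  rw [← hR] at h1
  refine h1.trans ?_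
  have hfac : (0 : ℝ) < (k + 1).factorial := by exact_mod_cast Nat.factorial_pos _
  rcases Nat.eq_zero_or_pos
    (matchings R (Finset.univ.erase t) (Finset.univ.erase s)).card with h0 | hpos
  · rw [h0, Nat.cast_zero]; positivity
  have hlog := log_card_matchings_le R (Finset.univ.erase t) (Finset.univ.erase s) (by simp)
  rw [← Real.log_le_log_iff (by exact_mod_cast hpos) (by positivity), Real.log_rpow hfac]
  refine hlog.trans ((Finset.sum_le_sum fun v _ => logFactorialMean_mono
    ((Finset.card_le_card Finset.inter_subset_left).trans (hRk v))).trans (le_of_eq ?_))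
  have hc : 1 ≤ Fintype.card V := Fintype.card_pos_iff.2 ⟨s⟩
  rw [Finset.sum_const, Finset.card_erase_of_mem (Finset.mem_univ _), Finset.card_univ,
    nsmul_eq_mul, Nat.cast_sub hc, logFactorialMean]
  push_cast
  ring

end Bregman

end MultiDigraph

theorem mainTheorem7 {V : Type*} [Fintype V] (n k : ℕ) (hk : 2 ≤ k) (hn : Fintype.card V = n)
    (G : MultiDigraph V) (hG : ∀ v, G.outdegree v = k) :
    (G.N₁ k : ℝ) ≤ 5 * (n : ℝ) ^ 2 * (k : ℝ) * MultiDigraph.α k ^ ((n : ℝ) - 1) ∧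
    (G.N₂ : ℝ) ≤
      (n : ℝ) ^ 2 * (k : ℝ) * (((k + 1).factorial : ℕ) : ℝ) ^ (((n : ℝ) - 1) / ((k : ℝ) + 1)) := by
  classical
  subst hn
  have total : ∀ (H : MultiDigraph V) (D : ℝ), (∀ v, H.outdegree v ≤ k) →
      (∀ s t, MultiDigraph.pathCount H.mult t Finset.univ s ≤ D) →
      (H.numPathCycles : ℝ) ≤ (Fintype.card V : ℝ) ^ 2 * k * D := by
    intro H D h1 h2
    refine (MultiDigraph.numPathCycles_le h1).trans ?_
    have h3 : ∑ s, ∑ t, MultiDigraph.pathCount H.mult t Finset.univ s ≤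
        ∑ _s : V, ∑ _t : V, D := Finset.sum_le_sum fun s _ => Finset.sum_le_sum fun t _ => h2 s t
    refine (mul_le_mul_of_nonneg_left h3 (Nat.cast_nonneg k)).trans (le_of_eq ?_)
    simp only [Finset.sum_const, Finset.card_univ, nsmul_eq_mul]
    ring
  have hentry : ∀ v u, G.mult v u ≤ k := fun v u => by
    rw [← hG v]
    exact Finset.single_le_sum (f := G.mult v) (fun _ _ => Nat.zero_le _) (Finset.mem_univ u)
  constructor
  · obtain ⟨m, rfl⟩ := Nat.exists_eq_add_of_le' (by omega : 1 ≤ k)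
    have hm : 1 ≤ m := by omega
    have hα0 : 0 < MultiDigraph.α (m + 1) := by
      rw [MultiDigraph.α, Nat.cast_add_one, add_sub_cancel_right]; positivity
    have hαα : MultiDigraph.α (m + 1) ^ 2 = m * MultiDigraph.α (m + 1) + 1 := by
      rw [MultiDigraph.α]
      push_cast
      have := Real.sq_sqrt (by positivity : (0 : ℝ) ≤ ((m : ℝ) + 1 - 1) ^ 2 + 4)
      linear_combination this / 4
    have hsum : ∀ v, ∑ u, (G.collapse (m + 1)).mult v u ≤ m + 1 := fun v => by
      refine le_trans (Finset.sum_le_sum fun u _ => ?_) (hG v).le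
      simp only [MultiDigraph.collapse]
      split_ifs <;> omega
    -- A multiplicity `m + 1` has become `1`, and `1 ≤ m` because `k ≥ 2`.
    have hent : ∀ v u, (G.collapse (m + 1)).mult v u ≤ m := fun v u => by
      have := hentry v u
      simp only [MultiDigraph.collapse]
      split_ifs <;> omega
    refine (total _ _ hsum fun s t =>
      MultiDigraph.pathCount_le_root_pow hm hα0 hαα hsum hent s t).trans ?_
    -- The truncated and the real exponent `n - 1` differ only for `n = 0`, where both sides vanish.
    rcases Nat.eq_zero_or_pos (Fintype.card V) with h0 | hpos
    · rw [h0]; simp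
    · have hexp : MultiDigraph.α (m + 1) ^ (Fintype.card V - 1) =
          MultiDigraph.α (m + 1) ^ ((Fintype.card V : ℝ) - 1) := by
        rw [← Real.rpow_natCast, Nat.cast_pred hpos]
      rw [hexp]
      have : 0 ≤ (Fintype.card V : ℝ) ^ 2 * ((m + 1 : ℕ) : ℝ) *
        MultiDigraph.α (m + 1) ^ ((Fintype.card V : ℝ) - 1) := by positivity
      linarith
  · have hsum : ∀ v, ∑ u, G.skel.mult v u ≤ k := fun v => by
      refine le_trans (Finset.sum_le_sum fun u _ => ?_) (hG v).le
      simp only [MultiDigraph.skel]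
      split_ifs <;> omega
    have hent : ∀ v u, G.skel.mult v u ≤ 1 := fun v u => by
      simp only [MultiDigraph.skel]
      split_ifs <;> omega
    exact total _ _ hsum fun s t => MultiDigraph.pathCount_le_factorial_rpow hent hsum s t
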